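/- Let $\alpha\ge 1$ be an integer. A plane partition is a finite set $P$ of points $(i,j,k)$ with positive integer coordinates such that $(i,j,k)\in P$ and $1\le i'\le i$, $1\le j'\le j$, $1\le k'\le k$ imply $(i',j',k')\in P$; the points are regarded as midpoints of unit cubes. Consider the plane partitions $P$ contained in the box $\{1,\dots,2\alpha\}^3$ that are cyclically symmetric, i.e. $(i,j,k)\in P$ implies $(j,k,i)\in P$, and transpose-complementary, i.e. for every $(i,j,k)$ in the box exactly one of $(i,j,k)$ and $(2\alpha+1-j,\,2\alpha+1-i,\,2\alpha+1-k)$ lies in $P$. For such $P$ let $n(P)$ be the number of cubes of $P$ in the upper right eighth of the box, that is, the number of $(i,j,k)\in P$ with $i\le\alpha$, $j>\alpha$, $k>\alpha$. Then the $(-1)$-enumeration $$\sum_{P}(-1)^{n(P)},$$ where $P$ runs over all cyclically symmetric transpose-complementary plane partitions in the $2\alpha\times2\alpha\times2\alpha$ box, equals $$\left(\prod_{k=1}^{(\alpha-1)/2}\frac{(6k-2)!}{(2k+\alpha-1)!}\right)^2\quad\text{for }\alpha\text{ odd},\qquad 0\quad\text{for }\alpha\text{ even}.$$ -/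

import Mathlib

/-- The box with side lengths `a`, `b`, `c`: the lattice points `(i, j, k)` with
`1 ≤ i ≤ a`, `1 ≤ j ≤ b`, `1 ≤ k ≤ c`, thought of as midpoints of unit cubes. -/
def box (a b c : ℕ) : Finset (ℕ × ℕ × ℕ) :=
  Finset.Icc 1 a ×ˢ Finset.Icc 1 b ×ˢ Finset.Icc 1 c

/-- A plane partition: a finite set of points with positive coordinates that is closed under
decreasing coordinates (as long as they stay positive). -/
structure IsPlanePartition (P : Finset (ℕ × ℕ × ℕ)) : Prop where
  pos : ∀ i j k : ℕ, (i, j, k) ∈ P → 1 ≤ i ∧ 1 ≤ j ∧ 1 ≤ k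
  down : ∀ i j k i' j' k' : ℕ, (i, j, k) ∈ P →
    1 ≤ i' → i' ≤ i → 1 ≤ j' → j' ≤ j → 1 ≤ k' → k' ≤ k → (i', j', k') ∈ P

/-- Cyclic symmetry of a set of cubes. -/
def IsCyclicallySymmetric (P : Finset (ℕ × ℕ × ℕ)) : Prop :=
  ∀ i j k : ℕ, (i, j, k) ∈ P → (j, k, i) ∈ P

/-- `P` is transpose-complementary in the box `a × a × c`: of every cube `(i, j, k)` of the box and
its image `(a + 1 - j, a + 1 - i, c + 1 - k)` exactly one lies in `P`. The subtractions do not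
truncate, since `(i, j, k)` ranges over the box. -/
def IsTransposeComplementary (a c : ℕ) (P : Finset (ℕ × ℕ × ℕ)) : Prop :=
  ∀ i j k : ℕ, (i, j, k) ∈ box a a c →
    ((i, j, k) ∈ P ↔ (a + 1 - j, a + 1 - i, c + 1 - k) ∉ P)

open Classical in
/-- The finite set of all cyclically symmetric transpose-complementary plane partitions contained in
the cube with side length `n`. -/
noncomputable def cstcPlanePartitions (n : ℕ) : Finset (Finset (ℕ × ℕ × ℕ)) :=
  (box n n n).powerset.filter fun P =>
    IsPlanePartition P ∧ IsCyclicallySymmetric P ∧ IsTransposeComplementary n n P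

/-- The number of cubes of `P` in the upper right eighth `i ≤ α`, `α < j`, `α < k` of the cube with
side length `2 * α`. With the `k`-axis pointing up, the `i`-axis down left and the `j`-axis down
right, this eighth is seen in the upper right of the hexagon. -/
def upperRightCubes (α : ℕ) (P : Finset (ℕ × ℕ × ℕ)) : ℕ :=
  (P.filter fun x => x.1 ≤ α ∧ α < x.2.1 ∧ α < x.2.2).card

/-- The `(-1)`-enumeration of the cyclically symmetric transpose-complementary plane partitions in
the cube with side length `2 * α`. -/
noncomputable def cstcMinusOneEnumeration (α : ℕ) : ℤ :=
  ∑ P ∈ cstcPlanePartitions (2 * α), (-1 : ℤ) ^ upperRightCubes α P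

/-!
Throughout, `α = n + 1`.

Transpose-complementation and cyclic symmetry determine a plane partition `P` of the kind considered
by its cubes in the eighth `i ≤ α < j, k` of the box. After shifting, these cubes form an arbitrary
plane partition `A` whose cubes satisfy `i + j ≤ n + 1` and `i + k ≤ n + 1` (`IsCornerIdeal`), and
the quantity to compute is the sum of `(-1) ^ A.card` (`cstcMinusOneEnumeration_eq`).

The boundaries of the layers of `A` are `n` nonintersecting lattice paths. Cutting them along the
main diagonal `j = k` gives two families of half paths with the same starting configuration
(`sum_cornerIdeals`). The signed number of families of half paths with a given starting
configuration is a determinant (`sum_pathFamilies`): by induction on the number of steps, one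
expands the determinant by multilinearity, and the choices that do not come from nonintersecting
paths contribute zero. The Cauchy–Binet formula sums the product of two such determinants over the
starting configurations and yields, up to sign, the determinant of `pathMatrix n`, whose entries
come from Gaussian binomial coefficients at `q = -1`.

These coefficients depend on parities, and `pathMatrix n` has a zero block on the even indices
`0, 2, …`. If `n` is odd, the even indices are in the majority and the determinant vanishes
(`det_pathMatrix_odd`). If `n = 2 * m`, the two off-diagonal blocks are transposes of each other
and, up to signs, equal to the matrix with entries `(i + j + 1).choose (2 * i - j)`, so that the
determinant is `±` the square of a Mills–Robbins–Rumsey determinant (`det_pathMatrix_even`).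

That determinant is evaluated in `det_mrrMatrix` by explicit hypergeometric column operations, in
the manner of Petkovšek and Wilf. The entries of the resulting triangular matrix satisfy a
first-order recurrence in the row index (`triEntry_recurrence`), proved by a Zeilberger-type
telescoping certificate; it gives both the zeros above the diagonal and the pivots.
-/

/-! ### Two expansions of determinants -/

/-- Multilinearity of the determinant when every row is a weighted sum of vectors `g x`. -/
lemma det_sum_rows {n : ℕ} {R : Type*} [CommRing R] (s : Fin n → Finset ℕ) (w : Fin n → ℕ → R)
    (g : ℕ → Fin n → R) :
    (Matrix.of fun i j => ∑ x ∈ s i, w i x * g x j).det =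
      ∑ p ∈ Fintype.piFinset s, (∏ i, w i (p i)) * (Matrix.of fun i j => g (p i) j).det := by
  have h := (Matrix.detRowAlternating (R := R) (n := Fin n)).toMultilinearMap.map_sum_finset
    (fun i x => w i x • g x) s
  simp only [AlternatingMap.coe_multilinearMap] at h
  have h1 : (Matrix.of fun i j => ∑ x ∈ s i, w i x * g x j) =
      fun i => ∑ x ∈ s i, w i x • g x := by
    ext i j
    simp
  rw [h1]
  refine h.trans (Finset.sum_congr rfl fun p _ => ?_)
  exact (Matrix.detRowAlternating (R := R) (n := Fin n)).map_smul_univ _ _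

/-- The Cauchy–Binet formula, with the minors indexed by strictly increasing functions. -/
lemma det_sum_mul_eq_sum_strictMono {n : ℕ} {R : Type*} [CommRing R] (N : ℕ)
    (a b : Fin n → ℕ → R) :
    (Matrix.of fun i j => ∑ x ∈ Finset.range N, a i x * b j x).det =
      ∑ c ∈ (Fintype.piFinset fun _ : Fin n => Finset.range N).filter StrictMono,
        (Matrix.of fun r j => a j (c r)).det * (Matrix.of fun r j => b j (c r)).det := by
  rw [det_sum_rows (fun _ => Finset.range N) a (fun x j => b j x)]
  rw [← Finset.sum_filter_of_ne (p := fun p => Function.Injective p)]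
  · have h : ∀ c : Fin n → ℕ,
        (Matrix.of fun r j => a j (c r)).det * (Matrix.of fun r j => b j (c r)).det =
          ∑ σ : Equiv.Perm (Fin n), (∏ i, a i ((c ∘ σ) i)) *
            (Matrix.of fun i j => b j ((c ∘ σ) i)).det := by
      intro c
      rw [Matrix.det_apply', Finset.sum_mul]
      refine Finset.sum_congr rfl fun σ _ => ?_
      have := Matrix.det_permute σ (Matrix.of fun r j => b j (c r))
      have h2 : (Matrix.of fun i j => b j ((c ∘ σ) i)) =
          (Matrix.of fun r j => b j (c r)).submatrix σ id := rfl
      rw [h2, this]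
      simp only [Matrix.of_apply, Function.comp_apply]
      ring
    simp_rw [h]
    rw [← Finset.sum_product']
    symm
    refine Finset.sum_bij (fun x _ => x.1 ∘ x.2) ?_ ?_ ?_ ?_
    · rintro ⟨c, σ⟩ hx
      simp only [Finset.mem_product, Finset.mem_filter, Fintype.mem_piFinset, Finset.mem_univ,
        and_true] at hx ⊢
      exact ⟨fun i => hx.1 _, hx.2.injective.comp σ.injective⟩
    · rintro ⟨c, σ⟩ hc ⟨c', σ'⟩ hc' heq
      simp only [Finset.mem_product, Finset.mem_filter, Finset.mem_univ, and_true] at hc hc' heq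
      have hcc : c = c' := by
        refine (StrictMono.range_inj hc.2 hc'.2).1 ?_
        rw [← σ.surjective.range_comp c, heq, σ'.surjective.range_comp]
      subst hcc
      have : σ = σ' := by
        ext i
        exact congrArg _ (hc.2.injective (congrFun heq i))
      rw [this]
    · intro p hp
      simp only [Finset.mem_filter, Fintype.mem_piFinset] at hp
      refine ⟨(p ∘ Tuple.sort p, (Tuple.sort p)⁻¹), ?_, ?_⟩
      · simp only [Finset.mem_product, Finset.mem_filter, Fintype.mem_piFinset, Finset.mem_univ,
          and_true]
        exact ⟨fun i => hp.1 _, (Tuple.monotone_sort p).strictMono_of_injective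
          (hp.2.comp (Tuple.sort p).injective)⟩
      · ext i
        simp
    · intros
      rfl
  · intro p _ hne
    by_contra hinj
    obtain ⟨i, j, hij, hne'⟩ : ∃ i j, p i = p j ∧ i ≠ j := by
      simpa [Function.Injective] using hinj
    apply hne
    rw [Matrix.det_zero_of_row_eq hne', mul_zero]
    ext k
    simp [hij]

/-! ### A Mills–Robbins–Rumsey determinant -/

/-- The binomial coefficient `n` over `z` for an integer `z`, zero when `z` is negative. It obeys
Pascal's rule and the absorption identity for every `z`, without truncated subtraction. -/
def intChoose (n : ℕ) (z : ℤ) : ℚ := if z < 0 then 0 else (n.choose z.toNat : ℚ)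

lemma intChoose_of_neg {n : ℕ} {z : ℤ} (h : z < 0) : intChoose n z = 0 := if_pos h

lemma intChoose_natCast (n m : ℕ) : intChoose n (m : ℤ) = n.choose m := by
  simp [intChoose]

lemma intChoose_of_lt {n : ℕ} {z : ℤ} (h : (n : ℤ) < z) : intChoose n z = 0 := by
  lift z to ℕ using by omega
  rw [intChoose_natCast, Nat.choose_eq_zero_of_lt (by omega), Nat.cast_zero]

lemma intChoose_succ (n : ℕ) (z : ℤ) :
    intChoose (n + 1) z = intChoose n z + intChoose n (z - 1) := by
  rcases lt_trichotomy z 0 with h | h | h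
  · simp [intChoose, h, show z - 1 < 0 by omega]
  · subst h
    simp [intChoose]
  · obtain ⟨m, rfl⟩ : ∃ m : ℕ, z = ((m + 1 : ℕ) : ℤ) := ⟨z.toNat - 1, by omega⟩
    have : ((m + 1 : ℕ) : ℤ) - 1 = (m : ℤ) := by push_cast; ring
    rw [this, intChoose_natCast, intChoose_natCast, intChoose_natCast, Nat.choose_succ_succ]
    push_cast
    ring

lemma mul_intChoose (n : ℕ) (z : ℤ) :
    (z : ℚ) * intChoose n z = (n - z + 1) * intChoose n (z - 1) := by
  rcases lt_trichotomy z 0 with h | h | h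
  · simp [intChoose, h, show z - 1 < 0 by omega]
  · subst h
    simp [intChoose]
  · obtain ⟨m, rfl⟩ : ∃ m : ℕ, z = ((m + 1 : ℕ) : ℤ) := ⟨z.toNat - 1, by omega⟩
    have : ((m + 1 : ℕ) : ℤ) - 1 = (m : ℤ) := by push_cast; ring
    rw [this, intChoose_natCast, intChoose_natCast]
    rcases le_or_gt m n with hm | hm
    · have := Nat.choose_succ_right_eq n m
      zify [hm] at this
      have h2 : ((n.choose (m + 1) : ℤ) : ℚ) * (m + 1) = (n.choose m : ℤ) * ((n : ℚ) - m) := by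
        exact_mod_cast this
      push_cast at h2 ⊢
      linarith
    · rw [Nat.choose_eq_zero_of_lt hm, Nat.choose_eq_zero_of_lt (by omega)]
      simp

/-- The matrix of Mills, Robbins and Rumsey with entries `(i + j + 1).choose (2 * i - j)`, where
the binomial coefficient is zero for `2 * i < j`. -/
def mrrMatrix (n : ℕ) : Matrix (Fin n) (Fin n) ℚ :=
  Matrix.of fun i j => intChoose (i + j + 1) (2 * i - j)

/-- The hypergeometric factor of the column operations that make `mrrMatrix` triangular,
normalised to be `1` at `k = u`. -/
def colWeight (u k : ℕ) : ℚ :=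
  ∏ l ∈ Finset.Ico k u,
    (-((2 * u - l - 1) * (2 * u + l + 4)) / (2 * (u - l) * (2 * u + 2 * l + 3)) : ℚ)

lemma colWeight_self (u : ℕ) : colWeight u u = 1 := by simp [colWeight]

lemma colWeight_step {u k : ℕ} (h : k < u) :
    2 * ((u : ℚ) - k) * (2 * u + 2 * k + 3) * colWeight u k =
      -((2 * u - k - 1) * (2 * u + k + 4)) * colWeight u (k + 1) := by
  have h1 : (u : ℚ) - k ≠ 0 := by
    have : (k : ℚ) < u := by exact_mod_cast h
    linarith
  have h2 : (2 * u + 2 * k + 3 : ℚ) ≠ 0 := by positivity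
  rw [colWeight, Finset.prod_eq_prod_Ico_succ_bot h, ← colWeight]
  field_simp

/-- The entry in row `v` of column `u` of the triangularised matrix, up to the factor
`u * (u + 1)`. -/
def triEntry (u v : ℕ) : ℚ :=
  ∑ k ∈ Finset.range (u + 1),
    (k * (k + 1) : ℚ) * colWeight u k * intChoose (k + v + 1) (2 * v - k)

/-- The quadratic polynomial in `k` of the Gosper certificate for `triEntry`. -/
def certPoly (v k : ℚ) : ℚ :=
  (9 * v ^ 2 + 21 * v + 14) * k ^ 2 - (3 * v + 2) * (v + 3) * k - 4 * (v + 1) * (v + 2)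

/-- The partial sums of the recurrence operator in `v` applied to the summand of `triEntry` have a
closed form, as produced by Zeilberger's algorithm; it contains the factor `u - m`. -/
lemma partial_sum_recurrence (u v m : ℕ) (hm : m ≤ u) :
    ∑ k ∈ Finset.range (m + 1), (k * (k + 1) : ℚ) * colWeight u k *
      (6 * (v + 1 - u) * (2 * v + 2 * u + 5) * (v + 1) * (3 * v + 2) *
          intChoose (k + (v + 1) + 1) (2 * ((v + 1 : ℕ) : ℤ) - k) -
        3 * (2 * u + 1 - v) * (v + 2 * u + 2) * (v + 2) * (3 * v + 5) *
          intChoose (k + v + 1) (2 * v - k)) =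
      certPoly v (m + 1) * intChoose (m + v + 2) (2 * v + 1 - m) *
        (-(2 * (u - m) * (2 * u + 2 * m + 3) * colWeight u m)) := by
  induction m with
  | zero =>
    simp only [zero_add, Finset.sum_range_one, Nat.cast_zero, zero_mul]
    symm
    rcases v with _ | _ | v
    · simp [certPoly]; norm_num
    · simp [certPoly]; norm_num
    · rw [intChoose_of_lt (by push_cast; omega)]
      simp
  | succ m ih =>
    rw [Finset.sum_range_succ, ih (by omega)]
    have hw := colWeight_step (show m < u by omega)
    rw [hw]
    have hn : m + 1 + (v + 1) + 1 = (m + 1 + v + 1) + 1 := by ring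
    have hn2 : m + 1 + v + 2 = (m + 1 + v + 1) + 1 := by ring
    have hn3 : m + v + 2 = m + 1 + v + 1 := by ring
    rw [hn, hn2, hn3, intChoose_succ _ (2 * ((v + 1 : ℕ) : ℤ) - ((m + 1 : ℕ) : ℤ)),
      intChoose_succ _ (2 * (v : ℤ) + 1 - ((m + 1 : ℕ) : ℤ))]
    set N := m + 1 + v + 1 with hN
    have r1 := mul_intChoose N (2 * ((v + 1 : ℕ) : ℤ) - ((m + 1 : ℕ) : ℤ))
    have r2 := mul_intChoose N (2 * (v : ℤ) + 1 - ((m + 1 : ℕ) : ℤ))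
    have e1 : 2 * ((v + 1 : ℕ) : ℤ) - ((m + 1 : ℕ) : ℤ) - 1 = 2 * (v : ℤ) - m := by
      push_cast; ring
    have e2 : 2 * (v : ℤ) + 1 - ((m + 1 : ℕ) : ℤ) = 2 * (v : ℤ) - m := by push_cast; ring
    have e3 : 2 * ((v + 1 : ℕ) : ℤ) - ((m + 1 : ℕ) : ℤ) = 2 * (v : ℤ) + 1 - m := by
      push_cast; ring
    have e4 : 2 * (v : ℤ) - ((m + 1 : ℕ) : ℤ) = 2 * (v : ℤ) - m - 1 := by push_cast; ring
    rw [e1, e3] at r1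
    rw [e2] at r2
    rw [e1, e2, e3, e4]
    generalize intChoose N (2 * (v : ℤ) + 1 - m) = c3 at r1 r2 ⊢
    generalize intChoose N (2 * (v : ℤ) - m) = d at r1 r2 ⊢
    generalize intChoose N (2 * (v : ℤ) - m - 1) = c2 at r1 r2 ⊢
    generalize colWeight u (m + 1) = w
    rw [hN] at r1 r2
    push_cast at r1 r2 ⊢
    obtain ⟨k, hk⟩ : ∃ k : ℚ, k = m + 1 := ⟨_, rfl⟩
    have hk' : (m : ℚ) = k - 1 := by linarith
    rw [hk'] at r1 r2 ⊢
    generalize (u : ℚ) = u at *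
    generalize (v : ℚ) = v at *
    unfold certPoly
    -- the claim is a combination of the two absorption relations between three adjacent binomial
    -- coefficients; the multipliers are found by polynomial division
    linear_combination (-w) * (- 42 * k - 64 * k ^ 2 - 14 * k ^ 3 - 93 * v * k - 122 * v * k ^
      2 - 21 * v * k ^ 3 - 75 * v ^ 2 * k - 84 * v ^ 2 * k ^ 2 - 9 * v ^ 2 * k ^ 3 - 18 * v ^ 3 *
      k - 18 * v ^ 3 * k ^ 2 + 24 * u + 48 * u * k + 12 * u * v + 36 * u * v * k + 16 * u ^ 2 + 32
      * u ^ 2 * k + 8 * u ^ 2 * v + 24 * u ^ 2 * v * k) * r1 + w * (60 * k + 72 * k ^ 2 + 28 * k ^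
      3 + 84 * v * k + 118 * v * k ^ 2 + 42 * v * k ^ 3 + 51 * v ^ 2 * k + 69 * v ^ 2 * k ^ 2 + 18
      * v ^ 2 * k ^ 3 + 9 * v ^ 3 * k + 9 * v ^ 3 * k ^ 2 + 48 * u * k + 12 * u * v + 36 * u * v *
      k + 32 * u ^ 2 * k + 8 * u ^ 2 * v + 24 * u ^ 2 * v * k) * r2

lemma triEntry_recurrence (u v : ℕ) :
    2 * ((v : ℚ) + 1 - u) * (2 * v + 2 * u + 5) * (v + 1) * (3 * v + 2) * triEntry u (v + 1) =
      (2 * u + 1 - v) * (v + 2 * u + 2) * (v + 2) * (3 * v + 5) * triEntry u v := by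
  have h := partial_sum_recurrence u v u le_rfl
  simp only [sub_self, mul_zero, zero_mul, neg_zero] at h
  have h2 : 6 * ((v : ℚ) + 1 - u) * (2 * v + 2 * u + 5) * (v + 1) * (3 * v + 2) *
      triEntry u (v + 1) - 3 * (2 * u + 1 - v) * (v + 2 * u + 2) * (v + 2) * (3 * v + 5) *
      triEntry u v = 0 := by
    rw [← h, triEntry, triEntry, Finset.mul_sum, Finset.mul_sum, ← Finset.sum_sub_distrib]
    refine Finset.sum_congr rfl fun k _ => ?_
    ring
  linarith

/-- Above the diagonal the entries vanish: the left-hand side of the recurrence has the factor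
`v + 1 - u`, which starts a descending induction at `v = u - 1`. -/
lemma triEntry_eq_zero (u d v : ℕ) (h : v + d + 1 = u) : triEntry u v = 0 := by
  induction d generalizing v with
  | zero =>
    have hr := triEntry_recurrence u v
    subst h
    push_cast at hr
    have : (2 * ((v : ℚ) + 0 + 1) + 1 - v) * (v + 2 * (v + 0 + 1) + 2) * (v + 2) *
        (3 * v + 5) ≠ 0 := by
      have : (2 * ((v : ℚ) + 0 + 1) + 1 - v) = v + 3 := by ring
      rw [this]
      positivity
    refine (mul_eq_zero.1 (hr.symm.trans ?_)).resolve_left this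
    ring
  | succ d ih =>
    have hr := triEntry_recurrence u v
    rw [ih (v + 1) (by omega), mul_zero] at hr
    subst h
    push_cast at hr
    have : (2 * ((v : ℚ) + (d + 1) + 1) + 1 - v) * (v + 2 * (v + (d + 1) + 1) + 2) * (v + 2) *
        (3 * v + 5) ≠ 0 := by
      have : (2 * ((v : ℚ) + (d + 1) + 1) + 1 - v) = v + 2 * d + 5 := by ring
      rw [this]
      positivity
    exact (mul_eq_zero.1 hr.symm).resolve_left this

lemma triEntry_last (u : ℕ) : triEntry u (2 * u + 1) = u * (u + 1) := by
  rw [triEntry, Finset.sum_range_succ, Finset.sum_eq_zero, colWeight_self]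
  · have : 2 * ((2 * u + 1 : ℕ) : ℤ) - u = ((3 * u + 2 : ℕ) : ℤ) := by push_cast; ring
    rw [this, intChoose_natCast, show u + (2 * u + 1) + 1 = 3 * u + 2 by ring, Nat.choose_self]
    simp
  · intro k hk
    rw [Finset.mem_range] at hk
    rw [intChoose_of_lt (by push_cast; omega), mul_zero]

open Nat in
/-- A closed form for `triEntry u (u + a)`, obtained by going down from row `2 * u + 1` to row
`u + a` by means of the recurrence. -/
lemma triEntry_closed_form (u w a : ℕ) (h : a + w = u + 1) :
    triEntry u (u + a) * ((2 * u + 2) * (6 * u + 5) * w ! * a ! * (2 * (u + a) + 2 * u + 4)! *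
        (3 * u + 3)! * (4 * u + 2)!) =
      u * (u + 1) * (u + a + 1) * (3 * (u + a) + 2) * (u + 1)! * (6 * u + 6)! *
        (u + a + u + 2)! * (u + a + 2 * u + 1)! := by
  induction w generalizing a with
  | zero =>
    obtain rfl : a = u + 1 := by omega
    rw [show u + (u + 1) = 2 * u + 1 by ring, triEntry_last,
      show 2 * (2 * u + 1) + 2 * u + 4 = 6 * u + 6 by ring,
      show 2 * u + 1 + u + 2 = 3 * u + 3 by ring,
      show 2 * u + 1 + 2 * u + 1 = 4 * u + 2 by ring]
    push_cast
    simp only [Nat.factorial_zero, Nat.cast_one]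
    ring
  | succ w ih =>
    have ih := ih (a + 1) (by omega)
    have hr := triEntry_recurrence u (u + a)
    rw [show u + (a + 1) = u + a + 1 by ring] at ih
    rw [show 2 * (u + a + 1) + 2 * u + 4 = 2 * (u + a) + 2 * u + 4 + 1 + 1 by ring,
      show u + a + 1 + u + 2 = u + a + u + 2 + 1 by ring,
      show u + a + 1 + 2 * u + 1 = u + a + 2 * u + 1 + 1 by ring] at ih
    simp only [Nat.factorial_succ (2 * (u + a) + 2 * u + 4 + 1),
      Nat.factorial_succ (2 * (u + a) + 2 * u + 4), Nat.factorial_succ (u + a + u + 2),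
      Nat.factorial_succ (u + a + 2 * u + 1), Nat.factorial_succ a] at ih
    rw [Nat.factorial_succ w]
    have hu : (u : ℚ) = a + w := by
      have : (a : ℚ) + (w + 1) = u + 1 := by exact_mod_cast h
      linarith
    generalize triEntry u (u + a + 1) = s' at *
    generalize triEntry u (u + a) = s at *
    push_cast at ih hr ⊢
    generalize ((2 * (u + a) + 2 * u + 4)! : ℚ) = f1 at *
    generalize ((u + a + u + 2)! : ℚ) = f2 at *
    generalize ((u + a + 2 * u + 1)! : ℚ) = f3 at *
    generalize ((u + 1)! : ℚ) = f4 at *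
    generalize ((3 * u + 3)! : ℚ) = f5 at *
    generalize ((4 * u + 2)! : ℚ) = f6 at *
    generalize ((6 * u + 6)! : ℚ) = f7 at *
    generalize (w ! : ℚ) = f8 at *
    generalize (a ! : ℚ) = f9 at *
    have hnz : ((u : ℚ) + a + 2) * (3 * (u + a) + 5) * (u + a + 2 * u + 2) ≠ 0 := by positivity
    apply mul_left_cancel₀ hnz
    have hw : (2 * (u : ℚ) + 1 - (u + a)) = w + 1 := by rw [hu]; ring
    rw [hw] at hr
    have hcan : ((u : ℚ) + a + u + 3) ≠ 0 := by positivity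
    apply mul_left_cancel₀ hcan
    linear_combination (-(2 * (u : ℚ) + 2) * (6 * u + 5) * f8 * f9 * f1 * f5 * f6 *
        (u + a + u + 3)) * hr +
      (((u : ℚ) + a + 1) * (3 * (u + a) + 2)) * ih

/-- The unitriangular matrix of column operations. Its first column is that of the identity matrix,
since the generic formula degenerates to `0 / 0` there. -/
def colOps (n : ℕ) : Matrix (Fin n) (Fin n) ℚ :=
  Matrix.of fun k u =>
    if u < k then 0 else if (u : ℕ) = 0 then 1 else
      (k * (k + 1) : ℚ) * colWeight u k / (u * (u + 1))

lemma det_colOps (n : ℕ) : (colOps n).det = 1 := by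
  rw [Matrix.det_of_isUpperTriangular]
  · refine Finset.prod_eq_one fun i _ => ?_
    simp only [colOps, Matrix.of_apply, lt_self_iff_false, if_false, colWeight_self]
    split_ifs with h
    · rfl
    · have : (i : ℚ) ≠ 0 := by exact_mod_cast h
      field_simp
  · intro i j hij
    simp only [id] at hij
    simp [colOps, hij]

lemma mrrMatrix_mul_colOps (n : ℕ) (v u : Fin n) (hu : (u : ℕ) ≠ 0) :
    (mrrMatrix n * colOps n) v u = triEntry u v / (u * (u + 1)) := by
  rw [Matrix.mul_apply, triEntry, Finset.sum_div]
  have h := Fin.sum_univ_eq_sum_range (fun k : ℕ =>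
    if (u : ℕ) < k then (0 : ℚ) else (k * (k + 1) : ℚ) * colWeight u k *
      intChoose (k + v + 1) (2 * v - k) / (u * (u + 1))) n
  trans ∑ k : Fin n, if (u : ℕ) < k then (0 : ℚ) else (k * (k + 1) : ℚ) * colWeight u k *
      intChoose (k + v + 1) (2 * v - k) / (u * (u + 1))
  · refine Finset.sum_congr rfl fun k _ => ?_
    simp only [mrrMatrix, colOps, Matrix.of_apply, Fin.lt_def, if_neg hu]
    split_ifs with h1
    · simp
    · rw [Nat.add_comm (v : ℕ) k]
      ring
  · rw [h]
    symm
    refine Finset.sum_subset_zero_on_sdiff ?_ ?_ ?_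
    · intro k hk
      have := u.2
      simp only [Finset.mem_range] at *
      omega
    · intro k hk
      simp only [Finset.mem_sdiff, Finset.mem_range] at hk
      rw [if_pos (by omega)]
    · intro k hk
      simp only [Finset.mem_range] at hk
      rw [if_neg (by omega)]

open Nat in
lemma det_mrrMatrix_eq_prod_pivots (n : ℕ) : (mrrMatrix n).det =
    ∏ u ∈ Finset.range n,
      ((6 * u + 4)! * (2 * u + 2)! : ℚ) / ((4 * u + 2)! * (4 * u + 4)!) := by
  have h : (mrrMatrix n * colOps n).det = (mrrMatrix n).det := by
    rw [Matrix.det_mul, det_colOps, mul_one]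
  rw [← h, Matrix.det_of_isLowerTriangular, Finset.prod_range]
  · refine Finset.prod_congr rfl fun u _ => ?_
    by_cases hu : (u : ℕ) = 0
    · have h0 : (mrrMatrix n * colOps n) u u = 1 := by
        rw [Matrix.mul_apply, Finset.sum_eq_single u]
        · simp [mrrMatrix, colOps, hu, intChoose]
        · intro k _ hk
          have : u < k := by
            rw [Fin.lt_def, hu]
            exact Nat.pos_of_ne_zero fun h0 => hk (Fin.ext (by rw [h0, hu]))
          simp [colOps, this]
        · simp
      rw [h0, hu]
      norm_num [Nat.factorial]
    · rw [mrrMatrix_mul_colOps n u u hu]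
      have hc := triEntry_closed_form u (u + 1) 0 (by ring)
      simp only [add_zero] at hc
      generalize ((u : Fin n) : ℕ) = u at hu hc ⊢
      rw [show 2 * u + 2 * u + 4 = 4 * u + 4 by ring, show u + u + 2 = 2 * u + 2 by ring,
        show u + 2 * u + 1 = 3 * u + 1 by ring] at hc
      simp only [Nat.factorial_succ (6 * u + 5), Nat.factorial_succ (6 * u + 4),
        Nat.factorial_succ (3 * u + 2), Nat.factorial_succ (3 * u + 1), Nat.factorial_zero] at hc
      have hu' : (u : ℚ) ≠ 0 := by exact_mod_cast hu
      have e1 : ((u + 1)! : ℚ) ≠ 0 := by positivity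
      have e2 : ((3 * u + 1)! : ℚ) ≠ 0 := by positivity
      rw [div_eq_div_iff (by positivity) (by positivity)]
      push_cast at hc
      have hz : (2 * (u : ℚ) + 2) * (6 * u + 5) * ((u + 1)! : ℚ) * ((3 * u + 3) * (3 * u + 2)) *
        ((3 * u + 1)! : ℚ) ≠ 0 := by positivity
      apply mul_left_cancel₀ hz
      linear_combination hc
  · intro i j hij
    have hij : (i : ℕ) < j := hij
    rw [mrrMatrix_mul_colOps n i j (by omega),
      triEntry_eq_zero j (j - i - 1) i (by omega), zero_div]

open Nat in
lemma prod_factorial_shift (n : ℕ) :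
    (∏ u ∈ Finset.range n, (2 * u + 2)!) * ∏ u ∈ Finset.range n, (2 * (n + u) + 2)! =
      ∏ u ∈ Finset.range n, ((4 * u + 2)! * (4 * u + 4)!) := by
  rw [← Finset.prod_range_add (fun u => (2 * u + 2)!) n n]
  induction n with
  | zero => simp
  | succ n ih =>
    rw [show n + 1 + (n + 1) = n + n + 1 + 1 by ring, Finset.prod_range_succ,
      Finset.prod_range_succ, ih, Finset.prod_range_succ,
      show 2 * (n + n) + 2 = 4 * n + 2 by ring, show 2 * (n + n + 1) + 2 = 4 * n + 4 by ring]
    ring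

open Nat in
/-- The Mills–Robbins–Rumsey determinant, which counts vertically symmetric alternating sign
matrices. -/
theorem det_mrrMatrix (n : ℕ) : (mrrMatrix n).det =
    ∏ k ∈ Finset.Icc 1 n, ((6 * k - 2)! : ℚ) / ((2 * k + 2 * n)! : ℚ) := by
  rw [det_mrrMatrix_eq_prod_pivots, ← Finset.Ico_add_one_right_eq_Icc,
    Finset.prod_Ico_eq_prod_range]
  simp only [Nat.add_sub_cancel]
  have h := prod_factorial_shift n
  have h' : (∏ u ∈ Finset.range n, ((2 * u + 2)! : ℚ)) *
      ∏ u ∈ Finset.range n, ((2 * (n + u) + 2)! : ℚ) =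
      ∏ u ∈ Finset.range n, (((4 * u + 2)! : ℚ) * (4 * u + 4)!) := by exact_mod_cast h
  rw [Finset.prod_div_distrib, Finset.prod_div_distrib, ← h', Finset.prod_mul_distrib,
    div_eq_div_iff]
  · have e1 : ∀ u, 6 * (1 + u) - 2 = 6 * u + 4 := fun u => by omega
    have e2 : ∀ u, 2 * (1 + u) + 2 * n = 2 * (n + u) + 2 := fun u => by ring
    simp only [e1, e2]
    ring
  · exact mul_ne_zero (Finset.prod_ne_zero_iff.2 fun _ _ => by positivity)
      (Finset.prod_ne_zero_iff.2 fun _ _ => by positivity)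
  · exact Finset.prod_ne_zero_iff.2 fun _ _ => by positivity

/-! ### The path weights at `q = -1` -/

/-- The signed number of lattice paths with `s` steps in which the height goes from `a` to `0`,
each step lowering it by `0` or `1`; the sign is `-1` to the power of the sum of the heights after
the steps. This is the Gaussian binomial coefficient of `s` over `a` at `q = -1`, times
`(-1) ^ (a.choose 2)`. -/
def signedPaths : ℕ → ℕ → ℤ
  | 0, 0 => 1
  | 0, _ + 1 => 0
  | s + 1, 0 => signedPaths s 0
  | s + 1, a + 1 => (-1) ^ (a + 1) * signedPaths s (a + 1) + (-1) ^ a * signedPaths s a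

/-- The case `q = -1` of Lucas' theorem for Gaussian binomial coefficients. -/
lemma signedPaths_values (s b : ℕ) :
    signedPaths (2 * s) (2 * b) = (-1) ^ b * s.choose b ∧
    signedPaths (2 * s) (2 * b + 1) = 0 ∧
    signedPaths (2 * s + 1) (2 * b) = (-1) ^ b * s.choose b ∧
    signedPaths (2 * s + 1) (2 * b + 1) = (-1) ^ b * s.choose b := by
  induction s generalizing b with
  | zero =>
    rcases b with _ | b
    · simp [signedPaths]
    · simp [signedPaths, Nat.mul_add]
  | succ s ih =>
    have h1 : ∀ b, signedPaths (2 * (s + 1)) (2 * b) = (-1) ^ b * (s + 1).choose b := by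
      intro b
      rcases b with _ | b
      · have := (ih 0).2.2.1
        simp only [Nat.mul_add, signedPaths, Nat.mul_zero] at this ⊢
        simpa using this
      · have e1 := (ih (b + 1)).2.2.1
        have e2 := (ih b).2.2.2
        rw [show 2 * (b + 1) = 2 * b + 1 + 1 by ring] at e1 ⊢
        rw [show 2 * (s + 1) = 2 * s + 1 + 1 by ring, signedPaths, e1, e2, Nat.choose_succ_succ]
        have : (-1 : ℤ) ^ (2 * b + 1) = -1 := by rw [pow_succ, pow_mul]; simp
        rw [pow_succ, this, pow_succ]
        push_cast
        ring
    have h2 : ∀ b, signedPaths (2 * (s + 1)) (2 * b + 1) = 0 := by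
      intro b
      have e1 := (ih b).2.2.1
      have e2 := (ih b).2.2.2
      rw [show 2 * (s + 1) = 2 * s + 1 + 1 by ring, signedPaths, e1, e2]
      have : (-1 : ℤ) ^ (2 * b) = 1 := by rw [pow_mul]; simp
      rw [pow_succ, this]
      ring
    refine ⟨h1 b, h2 b, ?_, ?_⟩
    · rcases b with _ | b
      · have := h1 0
        simp only [signedPaths, Nat.mul_zero] at this ⊢
        exact this
      · have e1 := h1 (b + 1)
        have e2 := h2 b
        rw [show 2 * (b + 1) = 2 * b + 1 + 1 by ring] at e1 ⊢
        rw [signedPaths, e1, e2]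
        have : (-1 : ℤ) ^ (2 * b) = 1 := by rw [pow_mul]; simp
        rw [pow_succ, pow_succ, this]
        ring
    · have e1 := h1 b
      have e2 := h2 b
      rw [signedPaths, e1, e2]
      have : (-1 : ℤ) ^ (2 * b) = 1 := by rw [pow_mul]; simp
      rw [this]
      ring

/-- The signed number of ways in which a path gets from position `p` to position `j`, when it has
`j + 1` steps of size `0` or `1` to do so. -/
def halfWeight (j p : ℕ) : ℤ := if j ≤ p then signedPaths (j + 1) (p - j) else 0

/-- The signed number of paths consisting of two half paths ending at `i` and at `j`. -/
def pathMatrix (n : ℕ) : Matrix (Fin n) (Fin n) ℤ :=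
  Matrix.of fun i j =>
    ∑ p ∈ Finset.range (2 * n), (-1) ^ p * halfWeight i p * halfWeight j p

lemma sum_range_two_mul {R : Type*} [AddCommMonoid R] (f : ℕ → R) (n : ℕ) :
    ∑ p ∈ Finset.range (2 * n), f p = ∑ b ∈ Finset.range n, (f (2 * b) + f (2 * b + 1)) := by
  induction n with
  | zero => simp
  | succ n ih =>
    rw [show 2 * (n + 1) = 2 * n + 1 + 1 by ring, Finset.sum_range_succ, Finset.sum_range_succ, ih,
      Finset.sum_range_succ, add_assoc]

lemma halfWeight_even_even (v b : ℕ) :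
    halfWeight (2 * v) (2 * b) = if v ≤ b then (-1) ^ (b - v) * (v.choose (b - v) : ℤ) else 0 := by
  unfold halfWeight
  by_cases h : v ≤ b
  · rw [if_pos (by omega), if_pos h, show 2 * b - 2 * v = 2 * (b - v) by omega]
    exact (signedPaths_values v (b - v)).2.2.1
  · rw [if_neg (by omega), if_neg h]

lemma halfWeight_even_odd (v b : ℕ) :
    halfWeight (2 * v) (2 * b + 1) =
      if v ≤ b then (-1) ^ (b - v) * (v.choose (b - v) : ℤ) else 0 := by
  unfold halfWeight
  by_cases h : v ≤ b
  · rw [if_pos (by omega), if_pos h, show 2 * b + 1 - 2 * v = 2 * (b - v) + 1 by omega]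
    exact (signedPaths_values v (b - v)).2.2.2
  · rw [if_neg (by omega), if_neg h]

lemma halfWeight_odd_even (a b : ℕ) : halfWeight (2 * a + 1) (2 * b) = 0 := by
  unfold halfWeight
  split_ifs with h
  · rw [show 2 * b - (2 * a + 1) = 2 * (b - a - 1) + 1 by omega]
    exact (signedPaths_values (a + 1) (b - a - 1)).2.1
  · rfl

lemma halfWeight_odd_odd (a b : ℕ) :
    halfWeight (2 * a + 1) (2 * b + 1) =
      if a ≤ b then (-1) ^ (b - a) * ((a + 1).choose (b - a) : ℤ) else 0 := by
  unfold halfWeight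
  by_cases h : a ≤ b
  · rw [if_pos (by omega), if_pos h, show 2 * b + 1 - (2 * a + 1) = 2 * (b - a) by omega]
    exact (signedPaths_values (a + 1) (b - a)).1
  · rw [if_neg (by omega), if_neg h]

lemma pathMatrix_even_even {n : ℕ} (i j : Fin n) (v w : ℕ) (hi : (i : ℕ) = 2 * v)
    (hj : (j : ℕ) = 2 * w) : pathMatrix n i j = 0 := by
  rw [pathMatrix, Matrix.of_apply, sum_range_two_mul]
  refine Finset.sum_eq_zero fun b _ => ?_
  rw [hi, hj, halfWeight_even_even, halfWeight_even_even, halfWeight_even_odd, halfWeight_even_odd,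
    pow_succ]
  ring

lemma pathMatrix_symm {n : ℕ} (i j : Fin n) : pathMatrix n i j = pathMatrix n j i := by
  simp only [pathMatrix, Matrix.of_apply]
  exact Finset.sum_congr rfl fun p _ => by ring

/-- A case of Vandermonde's convolution. -/
lemma sum_choose_mul_choose (N a v : ℕ) (hv : 2 * v < N) :
    ∑ b ∈ Finset.range N, (if a ≤ b ∧ v ≤ b then
      (((a + 1).choose (b - a) * v.choose (b - v) : ℕ) : ℚ) else 0) =
      intChoose (v + a + 1) (2 * v - a) := by
  have key : ∀ b, (if a ≤ b ∧ v ≤ b then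
      (((a + 1).choose (b - a) * v.choose (b - v) : ℕ) : ℚ) else 0) =
      if a ≤ b ∧ b ≤ 2 * v then (((a + 1).choose (b - a) * v.choose (2 * v - b) : ℕ) : ℚ)
        else 0 := by
    intro b
    by_cases ha : a ≤ b
    · rcases lt_or_ge b v with h | h
      · rw [if_neg (by omega)]
        split_ifs
        · rw [Nat.choose_eq_zero_of_lt (show v < 2 * v - b by omega)]
          simp
        · rfl
      · rcases le_or_gt b (2 * v) with h2 | h2
        · rw [if_pos ⟨ha, h⟩, if_pos ⟨ha, h2⟩, ← Nat.choose_symm (show b - v ≤ v by omega),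
            show v - (b - v) = 2 * v - b by omega]
        · rw [if_pos ⟨ha, h⟩, if_neg (by omega),
            Nat.choose_eq_zero_of_lt (show v < b - v by omega)]
          simp
    · rw [if_neg (by omega), if_neg (by omega)]
  simp_rw [key]
  rcases lt_or_ge (2 * v) a with h | h
  · rw [intChoose_of_neg (by omega)]
    exact Finset.sum_eq_zero fun b _ => if_neg (by omega)
  · have hc : (2 * (v : ℤ) - a) = ((2 * v - a : ℕ) : ℤ) := by omega
    rw [hc, intChoose_natCast, show v + a + 1 = a + 1 + v by ring, Nat.add_choose_eq,
      Finset.Nat.sum_antidiagonal_eq_sum_range_succ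
        (fun x y => (a + 1).choose x * v.choose y), Nat.cast_sum]
    rw [← Finset.sum_filter]
    symm
    refine Finset.sum_bij (fun x _ => x + a) ?_ ?_ ?_ ?_
    · intro x hx
      simp only [Finset.mem_range, Finset.mem_filter] at *
      omega
    · intro x _ y _ hxy
      exact Nat.add_right_cancel hxy
    · intro b hb
      simp only [Finset.mem_range, Finset.mem_filter] at hb
      exact ⟨b - a, by simp only [Finset.mem_range]; omega, by omega⟩
    · intro x hx
      rw [Nat.add_sub_cancel, show 2 * v - a - x = 2 * v - (x + a) by omega]

lemma pathMatrix_even_odd {n : ℕ} (i j : Fin n) (v a : ℕ) (hi : (i : ℕ) = 2 * v)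
    (hj : (j : ℕ) = 2 * a + 1) :
    (pathMatrix n i j : ℚ) = -((-1) ^ v * intChoose (v + a + 1) (2 * v - a) * (-1) ^ a) := by
  rw [pathMatrix, Matrix.of_apply, sum_range_two_mul, ← sum_choose_mul_choose n a v (by omega),
    Finset.mul_sum, Finset.sum_mul, ← Finset.sum_neg_distrib]
  push_cast
  refine Finset.sum_congr rfl fun b _ => ?_
  rw [hi, hj, halfWeight_even_even, halfWeight_odd_even, halfWeight_even_odd, halfWeight_odd_odd]
  by_cases hv : v ≤ b <;> by_cases ha : a ≤ b
  · obtain ⟨x, rfl⟩ := Nat.exists_eq_add_of_le hv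
    obtain ⟨y, hy⟩ := Nat.exists_eq_add_of_le ha
    rw [if_pos hv, if_pos ha, if_pos ⟨ha, hv⟩]
    have e1 : v + x - v = x := by omega
    have e2 : v + x - a = y := by omega
    rw [e1, e2]
    have s1 : (-1 : ℚ) ^ (2 * (v + x) + 1) = -1 := by rw [pow_succ, pow_mul]; simp
    have s2 : (-1 : ℚ) ^ x * (-1) ^ y = (-1) ^ v * (-1) ^ a := by
      rw [← pow_add, ← pow_add]
      have h3 : (-1 : ℚ) ^ (x + y) * (-1) ^ (v + a) = 1 := by
        rw [← pow_add, show x + y + (v + a) = 2 * (v + x) by omega, pow_mul]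
        simp
      have h4 : (-1 : ℚ) ^ (v + a) * (-1) ^ (v + a) = 1 := by
        rw [← pow_add, ← two_mul, pow_mul]
        simp
      have h5 : (-1 : ℚ) ^ (v + a) ≠ 0 := pow_ne_zero _ (by norm_num)
      exact mul_right_cancel₀ h5 (h3.trans h4.symm)
    push_cast
    rw [s1]
    linear_combination (-((v.choose x : ℚ) * ((a + 1).choose y : ℚ))) * s2
  · rw [if_neg ha, if_neg (show ¬(a ≤ b ∧ v ≤ b) by omega)]
    simp
  · rw [if_neg hv, if_neg (show ¬(a ≤ b ∧ v ≤ b) by omega)]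
    simp
  · rw [if_neg hv, if_neg (show ¬(a ≤ b ∧ v ≤ b) by omega)]
    simp

/-- In odd dimension the even indices, for which `pathMatrix` has a zero block, are in the
majority. -/
lemma det_pathMatrix_odd (m : ℕ) : (pathMatrix (2 * m + 1)).det = 0 := by
  rw [Matrix.det_apply]
  refine Finset.sum_eq_zero fun σ _ => ?_
  -- `m + 1` even indices cannot all be mapped to the `m` odd ones
  obtain ⟨v, w, hw⟩ : ∃ (v : Fin (m + 1)) (w : ℕ),
      (σ ⟨2 * v, by omega⟩ : ℕ) = 2 * w := by
    by_contra! hcon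
    have hodd : ∀ v : Fin (m + 1), (σ ⟨2 * v, by omega⟩ : ℕ) / 2 < m := by
      intro v
      have h1 := hcon v ((σ ⟨2 * v, by omega⟩ : ℕ) / 2)
      have := (σ ⟨2 * v, by omega⟩).2
      omega
    obtain ⟨x, y, hxy, he⟩ := Fintype.exists_ne_map_eq_of_card_lt
      (fun v : Fin (m + 1) => (⟨_, hodd v⟩ : Fin m)) (by simp)
    simp only [Fin.mk.injEq] at he
    have h1 := hcon x ((σ ⟨2 * x, by omega⟩ : ℕ) / 2)
    have h2 := hcon y ((σ ⟨2 * y, by omega⟩ : ℕ) / 2)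
    have h3 : σ ⟨2 * x, by omega⟩ = σ ⟨2 * y, by omega⟩ := Fin.ext (by omega)
    have h4 := σ.injective h3
    rw [Fin.mk.injEq] at h4
    exact hxy (Fin.ext (by omega))
  rw [Finset.prod_eq_zero (Finset.mem_univ (⟨2 * v, by omega⟩ : Fin (2 * m + 1))), smul_zero]
  exact pathMatrix_even_even _ _ w v hw rfl

/-- Splitting the indices below `2 * m` into even and odd ones. -/
noncomputable def evenOddEquiv (m : ℕ) : Fin m ⊕ Fin m ≃ Fin (2 * m) :=
  Equiv.ofBijective
    (Sum.elim (fun v => ⟨2 * v, by omega⟩) (fun a => ⟨2 * a + 1, by omega⟩)) (by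
      constructor
      · rintro (x | x) (y | y) h
        all_goals
          simp only [Sum.elim_inl, Sum.elim_inr, Fin.mk.injEq] at h
        · exact congrArg _ (Fin.ext (by omega))
        · omega
        · omega
        · exact congrArg _ (Fin.ext (by omega))
      · intro x
        rcases Nat.even_or_odd' (x : ℕ) with ⟨k, hk | hk⟩
        · exact ⟨Sum.inl ⟨k, by omega⟩, Fin.ext hk.symm⟩
        · exact ⟨Sum.inr ⟨k, by omega⟩, Fin.ext hk.symm⟩)

lemma det_fromBlocks_zero_topLeft {m : ℕ} {R : Type*} [CommRing R]
    (B C D : Matrix (Fin m) (Fin m) R) :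
    (Matrix.fromBlocks 0 B C D).det = (-1) ^ m * (B.det * C.det) := by
  have h1 : (Matrix.fromBlocks 0 1 1 0 : Matrix (Fin m ⊕ Fin m) (Fin m ⊕ Fin m) R).det =
      (-1) ^ m := by
    have h := congrArg Matrix.det (Matrix.fromBlocks_multiply (1 : Matrix (Fin m) (Fin m) R)
      (1 : Matrix (Fin m) (Fin m) R) 0 1 0 (1 : Matrix (Fin m) (Fin m) R) 1
      (0 : Matrix (Fin m) (Fin m) R))
    rw [Matrix.det_mul, Matrix.det_fromBlocks_zero₂₁] at h
    simp only [Matrix.det_one, mul_one, one_mul, mul_zero, add_zero, zero_add] at h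
    rw [h, Matrix.det_fromBlocks_one₁₁]
    simp [Matrix.det_neg]
  have h := congrArg Matrix.det (Matrix.fromBlocks_multiply B 0 D C 0 1 1 0)
  rw [Matrix.det_mul, Matrix.det_fromBlocks_zero₁₂, h1] at h
  simp only [mul_zero, add_zero, zero_add, mul_one] at h
  rw [← h]
  ring

/-- In even dimension the matrix consists, after separating even from odd indices, of a zero block,
a Mills–Robbins–Rumsey matrix with signs, its transpose, and an irrelevant block. -/
lemma det_pathMatrix_even (m : ℕ) :
    ((pathMatrix (2 * m)).det : ℚ) = (-1) ^ m * (mrrMatrix m).det ^ 2 := by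
  have hcast : ((pathMatrix (2 * m)).det : ℚ) =
      ((pathMatrix (2 * m)).map (Int.cast : ℤ → ℚ)).det :=
    (Int.castRingHom ℚ).map_det _
  rw [hcast, ← Matrix.det_submatrix_equiv_self (evenOddEquiv m)]
  set s : Fin m → ℚ := fun v => (-1) ^ (v : ℕ)
  set B : Matrix (Fin m) (Fin m) ℚ := -(Matrix.diagonal s * mrrMatrix m * Matrix.diagonal s) with hB
  have hBe : ∀ v a, B v a =
      -((-1) ^ (v : ℕ) * intChoose (v + a + 1) (2 * v - a) * (-1) ^ (a : ℕ)) := by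
    intro v a
    rw [hB, Matrix.neg_apply, Matrix.mul_diagonal, Matrix.diagonal_mul]
    rfl
  set X := ((pathMatrix (2 * m)).map (Int.cast : ℤ → ℚ)).submatrix (evenOddEquiv m)
    (evenOddEquiv m) with hX
  have hXB : X = Matrix.fromBlocks 0 B B.transpose X.toBlocks₂₂ := by
    ext (v | a) (w | b)
    · simp only [Matrix.fromBlocks_apply₁₁, Matrix.zero_apply, hX, Matrix.submatrix_apply,
        Matrix.map_apply]
      rw [pathMatrix_even_even _ _ v w rfl rfl, Int.cast_zero]
    · rw [Matrix.fromBlocks_apply₁₂, hBe,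
        ← pathMatrix_even_odd (evenOddEquiv m (Sum.inl v)) (evenOddEquiv m (Sum.inr b)) v b rfl rfl]
      rfl
    · rw [Matrix.fromBlocks_apply₂₁, Matrix.transpose_apply, hBe,
        ← pathMatrix_even_odd (evenOddEquiv m (Sum.inl w)) (evenOddEquiv m (Sum.inr a)) w a rfl rfl,
        pathMatrix_symm]
      rfl
    · rw [Matrix.fromBlocks_apply₂₂]
      rfl
  rw [hXB, det_fromBlocks_zero_topLeft, Matrix.det_transpose]
  have hs : (Matrix.diagonal s).det ^ 2 = 1 := by
    rw [Matrix.det_diagonal, ← Finset.prod_pow]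
    refine Finset.prod_eq_one fun i _ => ?_
    simp only [s]
    rw [← pow_mul, mul_comm, pow_mul]
    simp
  have hm : ((-1 : ℚ) ^ m) ^ 2 = 1 := by
    rw [← pow_mul, mul_comm, pow_mul]
    simp
  rw [hB, Matrix.det_neg, Matrix.det_mul, Matrix.det_mul, Fintype.card_fin]
  linear_combination ((-1 : ℚ) ^ m * (mrrMatrix m).det ^ 2 * (Matrix.diagonal s).det ^ 4) * hm +
    ((-1 : ℚ) ^ m * (mrrMatrix m).det ^ 2 * ((Matrix.diagonal s).det ^ 2 + 1)) * hs

/-! ### Families of nonintersecting half paths -/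

/-- The configurations that may follow `p` when `T` further steps remain: every position moves down
by `0` or `1`, positions stay distinct, and the `r`-th path has to be at its end point `r` as soon
as fewer than `n - r` steps remain. -/
def nextConfigs {n : ℕ} (T : ℕ) (p : Fin n → ℕ) : Finset (Fin n → ℕ) :=
  (Fintype.piFinset fun r => {p r, p r - 1}).filter fun q =>
    StrictMono q ∧ ∀ r : Fin n, r + T < n → q r = r

lemma mem_nextConfigs {n T : ℕ} {p q : Fin n → ℕ} : q ∈ nextConfigs T p ↔
    (∀ r, q r ≤ p r ∧ p r ≤ q r + 1) ∧ StrictMono q ∧ ∀ r : Fin n, r + T < n → q r = r := by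
  rw [nextConfigs, Finset.mem_filter, Fintype.mem_piFinset]
  refine and_congr (forall_congr' fun r => ?_) Iff.rfl
  rw [Finset.mem_insert, Finset.mem_singleton]
  omega

/-- The signed number of ways to get from position `p` to position `j` when `T` of the `n` steps
remain. Of these steps, the last `n - j - 1` are not available to a path with end point `j`. -/
def stepWeight (n T j p : ℕ) : ℤ := if j ≤ p then signedPaths (T + j + 1 - n) (p - j) else 0

lemma stepWeight_self_steps (n j p : ℕ) : stepWeight n n j p = halfWeight j p := by
  rw [stepWeight, halfWeight, Nat.add_assoc, Nat.add_sub_cancel_left]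

lemma stepWeight_of_le {n T j p : ℕ} (h : T + j + 1 ≤ n) :
    stepWeight n T j p = if p = j then 1 else 0 := by
  rw [stepWeight, Nat.sub_eq_zero_of_le h]
  rcases lt_trichotomy p j with h1 | h1 | h1
  · rw [if_neg (by omega), if_neg (by omega)]
  · subst h1
    simp [signedPaths]
  · rw [if_pos h1.le, if_neg (by omega), show p - j = (p - j - 1) + 1 by omega, signedPaths]

/-- The positions to which a path may move from `x` when `T` further steps remain. Positions up to
`n - T - 1` are frozen, because the paths ending there have reached their end points. -/
def moves (n T x : ℕ) : Finset ℕ := if n ≤ x + T then {x, x - 1} else {x}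

lemma neg_one_pow_sub_mul {x j : ℕ} (h : j ≤ x) : (-1 : ℤ) ^ (x + j) = (-1) ^ (x - j) := by
  rw [show x + j = (x - j) + 2 * j by omega, pow_add, pow_mul]
  simp

lemma stepWeight_succ {n T j x : ℕ} (hT : T < n) :
    stepWeight n (T + 1) j x = ∑ y ∈ moves n T x, (-1) ^ (y + j) * stepWeight n T j y := by
  unfold moves
  rcases lt_or_ge (T + j + 1) n with hj | hj
  · have hone : (-1 : ℤ) ^ (j + j) = 1 := by rw [← two_mul, pow_mul]; simp
    simp_rw [stepWeight_of_le (show T + j + 1 ≤ n by omega)]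
    rw [stepWeight_of_le (by omega)]
    by_cases h2 : n ≤ x + T
    · rw [if_pos h2, if_neg (by omega), Finset.sum_pair (by omega), if_neg (by omega),
        if_neg (by omega)]
      simp
    · rw [if_neg h2, Finset.sum_singleton]
      split_ifs with h1
      · rw [h1, hone, mul_one]
      · rw [mul_zero]
  · have hs : T + 1 + j + 1 - n = (T + j + 1 - n) + 1 := by omega
    unfold stepWeight
    rw [hs]
    rcases lt_trichotomy x j with h1 | h1 | h1
    · rw [if_neg (by omega)]
      symm
      refine Finset.sum_eq_zero fun y hy => ?_
      have : y ≤ x := by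
        split_ifs at hy
        · simp only [Finset.mem_insert, Finset.mem_singleton] at hy
          omega
        · simp only [Finset.mem_singleton] at hy
          omega
      rw [if_neg (by omega), mul_zero]
    · subst h1
      have hone : (-1 : ℤ) ^ (x + x) = 1 := by rw [← two_mul, pow_mul]; simp
      rw [if_pos le_rfl, Nat.sub_self, signedPaths]
      split_ifs with h2
      · rw [Finset.sum_pair (by omega), if_pos le_rfl, if_neg (by omega), hone, Nat.sub_self]
        ring
      · rw [Finset.sum_singleton, if_pos le_rfl, hone, Nat.sub_self, one_mul]
    · rw [if_pos h1.le, if_pos (by omega), Finset.sum_pair (by omega), if_pos h1.le,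
        if_pos (by omega), neg_one_pow_sub_mul h1.le, neg_one_pow_sub_mul (by omega)]
      obtain ⟨d, hd⟩ : ∃ d, x - j = d + 1 := ⟨x - j - 1, by omega⟩
      rw [hd, show x - 1 - j = d by omega, signedPaths]

lemma id_le_of_strictMono {n : ℕ} {p : Fin n → ℕ} (hp : StrictMono p) (r : Fin n) :
    (r : ℕ) ≤ p r := by
  obtain ⟨r, hr⟩ := r
  induction r with
  | zero => exact Nat.zero_le _
  | succ r ih =>
    have h1 := ih (by omega)
    have h2 := hp (show (⟨r, by omega⟩ : Fin n) < ⟨r + 1, hr⟩ from Nat.lt_succ_self r)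
    simp only at h1 ⊢
    omega

/-- The sign of a configuration: `-1` to the power of the sum of the heights above the end
points. -/
def configSign {n : ℕ} (p : Fin n → ℕ) : ℤ := ∏ r : Fin n, (-1) ^ (p r + r)

/-- One step of the Lindström–Gessel–Viennot argument. In the expansion of the determinant by
multilinearity, a choice of moves that is not an admissible configuration either puts two paths
at the same position, which gives two equal rows, or misses an end point, which gives a zero
column. -/
lemma sum_nextConfigs_det {n T : ℕ} (hT : T < n) (p : Fin n → ℕ) (hp : StrictMono p)
    (hend : ∀ r : Fin n, r + (T + 1) < n → p r = r) :
    ∑ q ∈ nextConfigs T p,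
        configSign q * (Matrix.of fun r j : Fin n => stepWeight n T j (q r)).det =
      (Matrix.of fun r j : Fin n => stepWeight n (T + 1) j (p r)).det := by
  have h1 : (Matrix.of fun r j : Fin n => stepWeight n (T + 1) j (p r)) =
      Matrix.of fun r j : Fin n => ∑ y ∈ moves n T (p r), (-1) ^ y *
        ((-1) ^ (j : ℕ) * stepWeight n T j y) := by
    ext r j
    simp only [Matrix.of_apply]
    rw [stepWeight_succ hT]
    exact Finset.sum_congr rfl fun y _ => by ring
  rw [h1, det_sum_rows (fun r => moves n T (p r)) (fun _ y => (-1) ^ y)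
    (fun y j => (-1) ^ (j : ℕ) * stepWeight n T j y)]
  have h2 : ∀ q : Fin n → ℕ, (∏ r, (-1 : ℤ) ^ q r) *
      (Matrix.of fun r j : Fin n => (-1) ^ (j : ℕ) * stepWeight n T j (q r)).det =
      configSign q * (Matrix.of fun r j : Fin n => stepWeight n T j (q r)).det := by
    intro q
    have h := Matrix.det_mul_row (fun j : Fin n => (-1 : ℤ) ^ (j : ℕ))
      (Matrix.of fun r j : Fin n => stepWeight n T j (q r))
    simp only [Matrix.of_apply] at h
    rw [h, configSign, ← mul_assoc, ← Finset.prod_mul_distrib]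
    simp only [pow_add]
  simp_rw [h2]
  refine Finset.sum_subset ?_ ?_
  · intro q hq
    obtain ⟨hstep, hmono, hq⟩ := mem_nextConfigs.1 hq
    rw [Fintype.mem_piFinset]
    intro r
    have hr := hstep r
    unfold moves
    split_ifs with h
    · rw [Finset.mem_insert, Finset.mem_singleton]
      omega
    · have hid := id_le_of_strictMono hp r
      have hqr := hq r (by omega)
      have hpr : p r = r := by
        by_cases hr' : (r : ℕ) + (T + 1) < n
        · exact hend r hr'
        · omega
      rw [Finset.mem_singleton, hqr, hpr]
  · intro q hq hnq
    rw [Fintype.mem_piFinset] at hq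
    have hstep : ∀ r, q r ≤ p r ∧ p r ≤ q r + 1 := by
      intro r
      have := hq r
      unfold moves at this
      split_ifs at this
      · rw [Finset.mem_insert, Finset.mem_singleton] at this
        omega
      · rw [Finset.mem_singleton] at this
        omega
    rw [mul_eq_zero]
    right
    by_cases hmono : StrictMono q
    · -- only the path ending at `n - T - 1` can have missed its end point
      obtain ⟨t, ht, hne⟩ : ∃ t : Fin n, t + T < n ∧ q t ≠ t := by
        by_contra! hcon
        exact hnq (mem_nextConfigs.2 ⟨hstep, hmono, hcon⟩)
      have hfix : ∀ r : Fin n, r + (T + 1) < n → q r = r := by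
        intro r hr
        have := hq r
        rw [hend r hr, moves, if_neg (by omega), Finset.mem_singleton] at this
        exact this
      have htT : (t : ℕ) + T + 1 = n := by
        by_contra hc
        exact hne (hfix t (by omega))
      refine Matrix.det_eq_zero_of_column_eq_zero t fun r => ?_
      rw [Matrix.of_apply, stepWeight_of_le (by omega), if_neg]
      rcases lt_trichotomy r t with h | h | h
      · rw [hfix r (by rw [Fin.lt_def] at h; omega)]
        exact fun he => h.ne (Fin.ext he)
      · rw [h]
        exact hne
      · have h3 := hmono h
        have h4 := id_le_of_strictMono hmono t
        omega
    · obtain ⟨a, b, hab, hle⟩ : ∃ a b, a < b ∧ q b ≤ q a := by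
        simpa [StrictMono] using hmono
      have h3 := hp hab
      have h4 := hstep a
      have h5 := hstep b
      refine Matrix.det_zero_of_row_eq hab.ne ?_
      ext j
      simp only [Matrix.of_apply]
      rw [show q a = q b by omega]

/-- The sequence with first term `p`, followed by `f`. -/
def consSeq {X : Type*} (p : X) (f : ℕ → X) : ℕ → X
  | 0 => p
  | s + 1 => f s

lemma consSeq_injective {X : Type*} (p : X) : Function.Injective (consSeq p) := by
  intro f g h
  funext s
  exact congrFun h (s + 1)

open Classical in
/-- The sequences of configurations that start with `p`, take `T` steps to reach the end points
`0, …, n - 1`, and stay there. -/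
noncomputable def pathFamilies {n : ℕ} : ℕ → (Fin n → ℕ) → Finset (ℕ → Fin n → ℕ)
  | 0, p => {consSeq p fun _ r => r}
  | T + 1, p => (nextConfigs T p).biUnion fun q => (pathFamilies T q).image (consSeq p)

lemma mem_pathFamilies {n T : ℕ} {p : Fin n → ℕ} {f : ℕ → Fin n → ℕ} : f ∈ pathFamilies T p ↔
    f 0 = p ∧ (∀ s < T, f (s + 1) ∈ nextConfigs (T - 1 - s) (f s)) ∧
      ∀ s, T < s → ∀ r : Fin n, f s r = r := by
  induction T generalizing p f with
  | zero =>
    simp only [pathFamilies, Finset.mem_singleton, Nat.not_lt_zero, false_imp_iff, implies_true,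
      true_and]
    constructor
    · rintro rfl
      refine ⟨rfl, fun s hs r => ?_⟩
      obtain ⟨s, rfl⟩ := Nat.exists_eq_add_of_lt hs
      simp [consSeq]
    · rintro ⟨h0, h⟩
      funext s r
      rcases s with _ | s
      · rw [h0, consSeq]
      · rw [h _ (Nat.succ_pos s), consSeq]
  | succ T ih =>
    simp only [pathFamilies, Finset.mem_biUnion, Finset.mem_image]
    constructor
    · rintro ⟨q, hq, g, hg, rfl⟩
      obtain ⟨h0, h1, h2⟩ := ih.1 hg
      refine ⟨rfl, fun s hs => ?_, fun s hs => ?_⟩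
      · rcases s with _ | s
        · simpa [consSeq, h0] using hq
        · have := h1 s (by omega)
          rwa [show T + 1 - 1 - (s + 1) = T - 1 - s by omega]
      · obtain ⟨s, rfl⟩ : ∃ s', s = s' + 1 := ⟨s - 1, by omega⟩
        exact h2 s (by omega)
    · rintro ⟨h0, h1, h2⟩
      refine ⟨f 1, ?_, fun s => f (s + 1), ih.2 ⟨rfl, fun s hs => ?_, fun s hs => ?_⟩, ?_⟩
      · have := h1 0 (Nat.succ_pos T)
        simpa [h0] using this
      · have := h1 (s + 1) (by omega)
        rwa [show T + 1 - 1 - (s + 1) = T - 1 - s by omega] at this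
      · exact h2 (s + 1) (by omega)
      · funext s
        rcases s with _ | s
        · rw [h0, consSeq]
        · rw [consSeq]

/-- The sign of the first `T` configurations after the starting one. -/
def familySign {n : ℕ} (T : ℕ) (f : ℕ → Fin n → ℕ) : ℤ :=
  ∏ s ∈ Finset.range T, configSign (f (s + 1))

/-- A signed enumeration of families of nonintersecting half paths is a determinant. -/
lemma sum_pathFamilies {n T : ℕ} (hT : T ≤ n) (p : Fin n → ℕ) (hp : StrictMono p)
    (hend : ∀ r : Fin n, r + T < n → p r = r) :
    ∑ f ∈ pathFamilies T p, familySign T f =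
      (Matrix.of fun r j : Fin n => stepWeight n T j (p r)).det := by
  classical
  induction T generalizing p with
  | zero =>
    have h1 : (Matrix.of fun r j : Fin n => stepWeight n 0 j (p r)) = 1 := by
      ext r j
      rw [Matrix.of_apply, stepWeight_of_le (by omega), hend r (by omega), Matrix.one_apply]
      simp only [Fin.ext_iff]
    rw [h1, Matrix.det_one]
    simp [pathFamilies, familySign]
  | succ T ih =>
    rw [← sum_nextConfigs_det (by omega) p hp hend, pathFamilies, Finset.sum_biUnion]
    · refine Finset.sum_congr rfl fun q hq => ?_
      obtain ⟨-, hmono, hq'⟩ := mem_nextConfigs.1 hq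
      rw [Finset.sum_image fun _ _ _ _ h => consSeq_injective p h, ← ih (by omega) q hmono hq',
        Finset.mul_sum]
      refine Finset.sum_congr rfl fun f hf => ?_
      have hf0 := (mem_pathFamilies.1 hf).1
      rw [familySign, Finset.prod_range_succ', familySign, mul_comm]
      simp only [consSeq, hf0]
    · intro q _ q' _ hne
      rw [Function.onFun, Finset.disjoint_left]
      intro f hf hf'
      obtain ⟨g, hg, rfl⟩ := Finset.mem_image.1 hf
      obtain ⟨g', hg', he⟩ := Finset.mem_image.1 hf'
      rw [consSeq_injective p he] at hg'
      exact hne ((mem_pathFamilies.1 hg).1.symm.trans (mem_pathFamilies.1 hg').1)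

/-- The possible starting configurations. -/
def startConfigs (n : ℕ) : Finset (Fin n → ℕ) :=
  (Fintype.piFinset fun _ : Fin n => Finset.range (2 * n)).filter StrictMono

/-- Gluing two families of half paths along their common starting configuration. -/
lemma sum_startConfigs (n : ℕ) :
    ∑ p ∈ startConfigs n, configSign p * (∑ f ∈ pathFamilies n p, familySign n f) ^ 2 =
      (∏ r : Fin n, (-1) ^ (r : ℕ)) * (pathMatrix n).det := by
  have h := det_sum_mul_eq_sum_strictMono (2 * n)
    (fun (j : Fin n) p => (-1 : ℤ) ^ p * halfWeight j p)
    (fun j p => halfWeight j p)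
  rw [pathMatrix, h, Finset.mul_sum]
  refine Finset.sum_congr rfl fun p hp => ?_
  have hp := Finset.mem_filter.1 hp
  rw [sum_pathFamilies le_rfl p hp.2 (fun r hr => by omega)]
  have h1 := Matrix.det_mul_column (fun r : Fin n => (-1 : ℤ) ^ p r)
    (Matrix.of fun r j : Fin n => halfWeight j (p r))
  simp only [Matrix.of_apply] at h1
  rw [h1]
  simp only [stepWeight_self_steps, configSign, pow_add, Finset.prod_mul_distrib]
  ring

/-! ### Corner ideals and their diagonal slices -/

/-- A plane partition all of whose cubes satisfy `i + j ≤ n + 1` and `i + k ≤ n + 1`. -/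
structure IsCornerIdeal (n : ℕ) (A : Finset (ℕ × ℕ × ℕ)) : Prop where
  isPlanePartition : IsPlanePartition A
  le : ∀ i j k : ℕ, (i, j, k) ∈ A → i + j ≤ n + 1 ∧ i + k ≤ n + 1

open Classical in
/-- The finite set of all corner ideals. -/
noncomputable def cornerIdeals (n : ℕ) : Finset (Finset (ℕ × ℕ × ℕ)) :=
  (box n n n).powerset.filter fun A => IsCornerIdeal n A

lemma mem_box {a b c i j k : ℕ} : (i, j, k) ∈ box a b c ↔
    (1 ≤ i ∧ i ≤ a) ∧ (1 ≤ j ∧ j ≤ b) ∧ 1 ≤ k ∧ k ≤ c := by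
  simp [box]

lemma mem_cornerIdeals {n : ℕ} {A : Finset (ℕ × ℕ × ℕ)} :
    A ∈ cornerIdeals n ↔ IsCornerIdeal n A := by
  classical
  rw [cornerIdeals, Finset.mem_filter, Finset.mem_powerset]
  refine ⟨fun h => h.2, fun h => ⟨?_, h⟩⟩
  rintro ⟨i, j, k⟩ hx
  have h1 := h.isPlanePartition.pos i j k hx
  have h2 := h.le i j k hx
  rw [mem_box]
  omega

/-- To be closed under decreasing coordinates it suffices to be closed under decreasing one
coordinate by one. -/
lemma isPlanePartition_of_steps {A : Finset (ℕ × ℕ × ℕ)}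
    (pos : ∀ i j k : ℕ, (i, j, k) ∈ A → 1 ≤ i ∧ 1 ≤ j ∧ 1 ≤ k)
    (h₁ : ∀ i j k : ℕ, 1 ≤ i → (i + 1, j, k) ∈ A → (i, j, k) ∈ A)
    (h₂ : ∀ i j k : ℕ, 1 ≤ j → (i, j + 1, k) ∈ A → (i, j, k) ∈ A)
    (h₃ : ∀ i j k : ℕ, 1 ≤ k → (i, j, k + 1) ∈ A → (i, j, k) ∈ A) : IsPlanePartition A := by
  have d₁ : ∀ d i j k : ℕ, 1 ≤ i → (i + d, j, k) ∈ A → (i, j, k) ∈ A := by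
    intro d
    induction d with
    | zero => exact fun i j k _ h => h
    | succ d ih => exact fun i j k hi h => ih i j k hi (h₁ _ _ _ (by omega) h)
  have d₂ : ∀ d i j k : ℕ, 1 ≤ j → (i, j + d, k) ∈ A → (i, j, k) ∈ A := by
    intro d
    induction d with
    | zero => exact fun i j k _ h => h
    | succ d ih => exact fun i j k hi h => ih i j k hi (h₂ _ _ _ (by omega) h)
  have d₃ : ∀ d i j k : ℕ, 1 ≤ k → (i, j, k + d) ∈ A → (i, j, k) ∈ A := by
    intro d
    induction d with
    | zero => exact fun i j k _ h => h
    | succ d ih => exact fun i j k hi h => ih i j k hi (h₃ _ _ _ (by omega) h)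
  refine ⟨pos, fun i j k i' j' k' h hi hi' hj hj' hk hk' => ?_⟩
  obtain ⟨a, rfl⟩ := Nat.exists_eq_add_of_le hi'
  obtain ⟨b, rfl⟩ := Nat.exists_eq_add_of_le hj'
  obtain ⟨c, rfl⟩ := Nat.exists_eq_add_of_le hk'
  exact d₁ a _ _ _ hi (d₂ b _ _ _ hj (d₃ c _ _ _ hk h))

/-- The reflection of a set of cubes that exchanges the last two coordinates. -/
def reflect (A : Finset (ℕ × ℕ × ℕ)) : Finset (ℕ × ℕ × ℕ) :=
  A.image fun x => (x.1, x.2.2, x.2.1)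

lemma mem_reflect {A : Finset (ℕ × ℕ × ℕ)} {i j k : ℕ} :
    (i, j, k) ∈ reflect A ↔ (i, k, j) ∈ A := by
  rw [reflect, Finset.mem_image]
  constructor
  · rintro ⟨⟨a, b, c⟩, h, he⟩
    simp only [Prod.mk.injEq] at he
    obtain ⟨rfl, rfl, rfl⟩ := he
    exact h
  · exact fun h => ⟨_, h, rfl⟩

lemma IsCornerIdeal.reflect {n : ℕ} {A : Finset (ℕ × ℕ × ℕ)} (hA : IsCornerIdeal n A) :
    IsCornerIdeal n (reflect A) := by
  refine ⟨⟨fun i j k h => ?_, fun i j k i' j' k' h hi hi' hj hj' hk hk' => ?_⟩, fun i j k h => ?_⟩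
  · have := hA.isPlanePartition.pos _ _ _ (mem_reflect.1 h)
    omega
  · exact mem_reflect.2
      (hA.isPlanePartition.down _ _ _ _ _ _ (mem_reflect.1 h) hi hi' hk hk' hj hj')
  · have := hA.le _ _ _ (mem_reflect.1 h)
    omega

/-- The number of cubes of `A` in layer `n - r` on the diagonal at distance `s` above the main
one. -/
def sliceLength (n : ℕ) (A : Finset (ℕ × ℕ × ℕ)) (s r : ℕ) : ℕ :=
  ((Finset.Icc 1 n).filter fun j => (n - r, j, j + s) ∈ A).card

/-- The sequence of configurations that records the diagonals of `A` on and above the main one. The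
boundary of layer `n - r` is the `r`-th path; adding `r` makes the positions distinct. -/
def profile (n : ℕ) (A : Finset (ℕ × ℕ × ℕ)) : ℕ → Fin n → ℕ := fun s r => r + sliceLength n A s r

lemma le_sliceLength_iff {n : ℕ} {A : Finset (ℕ × ℕ × ℕ)} (hA : IsCornerIdeal n A) {r : ℕ}
    (hr : r < n) {j : ℕ} (hj : 1 ≤ j) (s : ℕ) :
    j ≤ sliceLength n A s r ↔ (n - r, j, j + s) ∈ A := by
  unfold sliceLength
  constructor
  · intro h
    by_contra hn
    have hsub : ((Finset.Icc 1 n).filter fun j => (n - r, j, j + s) ∈ A) ⊆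
        Finset.Icc 1 (j - 1) := by
      intro x hx
      rw [Finset.mem_filter, Finset.mem_Icc] at hx
      rw [Finset.mem_Icc]
      refine ⟨hx.1.1, ?_⟩
      by_contra hlt
      exact hn (hA.isPlanePartition.down _ _ _ _ _ _ hx.2 (by omega) le_rfl hj (by omega)
        (by omega) (by omega))
    have := Finset.card_le_card hsub
    rw [Nat.card_Icc] at this
    omega
  · intro h
    have hle := hA.le _ _ _ h
    have hsub : Finset.Icc 1 j ⊆ ((Finset.Icc 1 n).filter fun j => (n - r, j, j + s) ∈ A) := by
      intro x hx
      rw [Finset.mem_Icc] at hx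
      rw [Finset.mem_filter, Finset.mem_Icc]
      exact ⟨by omega, hA.isPlanePartition.down _ _ _ _ _ _ h (by omega) le_rfl hx.1 hx.2
        (by omega) (by omega)⟩
    have := Finset.card_le_card hsub
    rw [Nat.card_Icc] at this
    omega

/-- The sequences of configurations traced out by nonintersecting half paths. -/
structure IsPathFamily {n : ℕ} (f : ℕ → Fin n → ℕ) : Prop where
  strictMono : ∀ s, StrictMono (f s)
  step : ∀ s r, f (s + 1) r ≤ f s r ∧ f s r ≤ f (s + 1) r + 1
  fixed : ∀ (s : ℕ) (r : Fin n), r < s → f s r = r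

lemma mem_pathFamilies_iff {n : ℕ} {p : Fin n → ℕ} (hp : StrictMono p) {f : ℕ → Fin n → ℕ} :
    f ∈ pathFamilies n p ↔ f 0 = p ∧ IsPathFamily f := by
  rw [mem_pathFamilies]
  refine and_congr_right fun h0 => ⟨fun ⟨h1, h2⟩ => ?_, fun h => ⟨fun s hs => ?_, fun s hs r => ?_⟩⟩
  · have hfix : ∀ (s : ℕ) (r : Fin n), r < s → f s r = r := by
      intro s r hs
      rcases le_or_gt s n with h | h
      · obtain ⟨s, rfl⟩ : ∃ s', s = s' + 1 := ⟨s - 1, by omega⟩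
        exact (mem_nextConfigs.1 (h1 s (by omega))).2.2 r (by omega)
      · exact h2 s h r
    refine ⟨fun s => ?_, fun s r => ?_, hfix⟩
    · rcases le_or_gt s n with h | h
      · rcases s with _ | s
        · rwa [h0]
        · exact (mem_nextConfigs.1 (h1 s (by omega))).2.1
      · intro a b hab
        rw [h2 s h, h2 s h]
        exact hab
    · rcases lt_or_ge s n with h | h
      · exact (mem_nextConfigs.1 (h1 s h)).1 r
      · rw [hfix s r (by omega), hfix (s + 1) r (by omega)]
        omega
  · exact mem_nextConfigs.2 ⟨h.step s, h.strictMono _, fun r hr => h.fixed _ r (by omega)⟩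
  · exact h.fixed s r (by omega)

lemma IsCornerIdeal.isPathFamily_profile {n : ℕ} {A : Finset (ℕ × ℕ × ℕ)} (hA : IsCornerIdeal n A) :
    IsPathFamily (profile n A) := by
  refine ⟨fun s a b hab => ?_, fun s r => ⟨?_, ?_⟩, fun s r hs => ?_⟩
  · have hab' : (a : ℕ) < b := hab
    unfold profile
    have h : sliceLength n A s a ≤ sliceLength n A s b := by
      refine Finset.card_le_card fun j hj => ?_
      rw [Finset.mem_filter, Finset.mem_Icc] at hj ⊢
      exact ⟨hj.1, hA.isPlanePartition.down _ _ _ _ _ _ hj.2 (by omega) (by omega) hj.1.1 le_rfl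
        (by omega) le_rfl⟩
    omega
  · refine Nat.add_le_add_left (Finset.card_le_card fun j hj => ?_) _
    rw [Finset.mem_filter, Finset.mem_Icc] at hj ⊢
    exact ⟨hj.1, hA.isPlanePartition.down _ _ _ _ _ _ hj.2 (by omega) le_rfl hj.1.1 le_rfl
      (by omega) (by omega)⟩
  · unfold profile
    by_contra hlt
    have h1 := (le_sliceLength_iff hA r.2 (show 1 ≤ sliceLength n A s r by omega) s).1 le_rfl
    have h2 := (le_sliceLength_iff hA r.2 (show 1 ≤ sliceLength n A s r - 1 by omega) (s + 1)).2
      (hA.isPlanePartition.down _ _ _ _ _ _ h1 (by omega) le_rfl (by omega) (by omega)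
        (by omega) (by omega))
    omega
  · unfold profile
    by_contra hne
    have h1 := (le_sliceLength_iff hA r.2 (show 1 ≤ sliceLength n A s r by omega) s).1 le_rfl
    have := hA.le _ _ _ h1
    omega

lemma IsPathFamily.add_le {n : ℕ} {f : ℕ → Fin n → ℕ} (hf : IsPathFamily f) (r : Fin n) (d s : ℕ)
    (h : s + d = r + 1) : f s r ≤ r + d := by
  induction d generalizing s with
  | zero => rw [hf.fixed s r (by omega), add_zero]
  | succ d ih =>
    have h1 := ih (s + 1) (by omega)
    have h2 := (hf.step s r).2
    omega

lemma IsPathFamily.mem_startConfigs {n : ℕ} {f : ℕ → Fin n → ℕ} (hf : IsPathFamily f) :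
    f 0 ∈ startConfigs n := by
  rw [startConfigs, Finset.mem_filter, Fintype.mem_piFinset]
  refine ⟨fun r => ?_, hf.strictMono 0⟩
  have := hf.add_le r (r + 1) 0 (by omega)
  rw [Finset.mem_range]
  omega

/-- The set of cubes whose diagonals on and above the main one are recorded by `f`, and those on
and below it by `g`. -/
def ofFamilies (n : ℕ) (f g : ℕ → Fin n → ℕ) : Finset (ℕ × ℕ × ℕ) :=
  (box n n n).filter fun x => ∃ r : Fin n, x.1 + r = n ∧
    ((x.2.1 ≤ x.2.2 ∧ x.2.1 + r ≤ f (x.2.2 - x.2.1) r) ∨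
      (x.2.2 ≤ x.2.1 ∧ x.2.2 + r ≤ g (x.2.1 - x.2.2) r))

lemma mem_ofFamilies {n : ℕ} {f g : ℕ → Fin n → ℕ} (hf : IsPathFamily f) (hg : IsPathFamily g)
    {i j k : ℕ} : (i, j, k) ∈ ofFamilies n f g ↔ 1 ≤ j ∧ 1 ≤ k ∧ ∃ r : Fin n, i + r = n ∧
      ((j ≤ k ∧ j + r ≤ f (k - j) r) ∨ (k ≤ j ∧ k + r ≤ g (j - k) r)) := by
  rw [ofFamilies, Finset.mem_filter, mem_box]
  constructor
  · rintro ⟨h, h'⟩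
    exact ⟨h.2.1.1, h.2.2.1, h'⟩
  · rintro ⟨hj, hk, r, hr, h⟩
    refine ⟨⟨by omega, ?_⟩, r, hr, h⟩
    rcases h with ⟨hjk, h⟩ | ⟨hjk, h⟩
    · by_cases hs : (r : ℕ) < k - j
      · rw [hf.fixed _ _ hs] at h
        omega
      · have := hf.add_le r (r + 1 - (k - j)) (k - j) (by omega)
        omega
    · by_cases hs : (r : ℕ) < j - k
      · rw [hg.fixed _ _ hs] at h
        omega
      · have := hg.add_le r (r + 1 - (j - k)) (j - k) (by omega)
        omega

lemma reflect_ofFamilies {n : ℕ} {f g : ℕ → Fin n → ℕ} (hf : IsPathFamily f) (hg : IsPathFamily g) :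
    reflect (ofFamilies n f g) = ofFamilies n g f := by
  ext ⟨i, j, k⟩
  rw [mem_reflect, mem_ofFamilies hf hg, mem_ofFamilies hg hf]
  constructor
  all_goals
    rintro ⟨h1, h2, r, hr, h⟩
    exact ⟨h2, h1, r, hr, h.symm⟩

lemma ofFamilies_step {n : ℕ} {f g : ℕ → Fin n → ℕ} (hf : IsPathFamily f) (hg : IsPathFamily g)
    (h0 : f 0 = g 0) {i j k : ℕ} (hj : 1 ≤ j) (h : (i, j + 1, k) ∈ ofFamilies n f g) :
    (i, j, k) ∈ ofFamilies n f g := by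
  rw [mem_ofFamilies hf hg] at h ⊢
  obtain ⟨-, hk, r, hr, h⟩ := h
  refine ⟨hj, hk, r, hr, ?_⟩
  rcases h with ⟨hjk, h⟩ | ⟨hjk, h⟩
  · left
    have := (hf.step (k - (j + 1)) r).2
    rw [show k - (j + 1) + 1 = k - j by omega] at this
    omega
  · rcases Nat.eq_or_lt_of_le hjk with he | hlt
    · left
      subst he
      have := (hf.step 0 r).2
      rw [zero_add] at this
      rw [Nat.sub_self, ← h0] at h
      rw [Nat.add_sub_cancel_left]
      omega
    · right
      have := (hg.step (j - k) r).1
      rw [show j - k + 1 = j + 1 - k by omega] at this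
      omega

lemma isCornerIdeal_ofFamilies {n : ℕ} {f g : ℕ → Fin n → ℕ} (hf : IsPathFamily f)
    (hg : IsPathFamily g) (h0 : f 0 = g 0) : IsCornerIdeal n (ofFamilies n f g) := by
  refine ⟨isPlanePartition_of_steps ?_ ?_ (fun i j k hj h => ofFamilies_step hf hg h0 hj h) ?_, ?_⟩
  · intro i j k h
    have h' := (mem_ofFamilies hf hg).1 h
    obtain ⟨h1, h2, r, hr, -⟩ := h'
    omega
  · intro i j k hi h
    rw [mem_ofFamilies hf hg] at h ⊢
    obtain ⟨hj, hk, r, hr, h⟩ := h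
    refine ⟨hj, hk, ⟨r + 1, by omega⟩, by simp only; omega, ?_⟩
    have hlt : r < ⟨r + 1, by omega⟩ := Nat.lt_succ_self (r : ℕ)
    rcases h with ⟨hjk, h⟩ | ⟨hjk, h⟩
    · left
      have := hf.strictMono (k - j) hlt
      simp only
      omega
    · right
      have := hg.strictMono (j - k) hlt
      simp only
      omega
  · intro i j k hk h
    rw [← mem_reflect, reflect_ofFamilies hf hg] at h ⊢
    exact ofFamilies_step hg hf h0.symm hk h
  · intro i j k h
    obtain ⟨hj, hk, r, hr, h⟩ := (mem_ofFamilies hf hg).1 h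
    rcases h with ⟨hjk, h⟩ | ⟨hjk, h⟩
    · by_cases hs : (r : ℕ) < k - j
      · rw [hf.fixed _ _ hs] at h
        omega
      · have := hf.add_le r (r + 1 - (k - j)) (k - j) (by omega)
        omega
    · by_cases hs : (r : ℕ) < j - k
      · rw [hg.fixed _ _ hs] at h
        omega
      · have := hg.add_le r (r + 1 - (j - k)) (j - k) (by omega)
        omega

lemma profile_ofFamilies {n : ℕ} {f g : ℕ → Fin n → ℕ} (hf : IsPathFamily f)
    (hg : IsPathFamily g) (h0 : f 0 = g 0) : profile n (ofFamilies n f g) = f := by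
  funext s r
  have hA := isCornerIdeal_ofFamilies hf hg h0
  have hid := id_le_of_strictMono (hf.strictMono s) r
  have key : ∀ j, 1 ≤ j → (j ≤ sliceLength n (ofFamilies n f g) s r ↔ j + r ≤ f s r) := by
    intro j hj
    rw [le_sliceLength_iff hA r.2 hj s, mem_ofFamilies hf hg]
    constructor
    · rintro ⟨-, -, r', hr', h⟩
      obtain rfl : r' = r := Fin.ext (by omega)
      rcases h with ⟨-, h⟩ | ⟨hle, h⟩
      · rwa [Nat.add_sub_cancel_left] at h
      · obtain rfl : s = 0 := by omega
        rw [h0]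
        simpa using h
    · intro h
      exact ⟨hj, by omega, r, by omega, Or.inl ⟨by omega, by rwa [Nat.add_sub_cancel_left]⟩⟩
  unfold profile
  set c := sliceLength n (ofFamilies n f g) s r
  have h1 := key (c + 1) (by omega)
  rcases Nat.eq_zero_or_pos c with hc | hc
  · omega
  · have h2 := key c hc
    omega

lemma ofFamilies_profile {n : ℕ} {A : Finset (ℕ × ℕ × ℕ)} (hA : IsCornerIdeal n A) :
    ofFamilies n (profile n A) (profile n (reflect A)) = A := by
  ext ⟨i, j, k⟩
  rw [mem_ofFamilies hA.isPathFamily_profile hA.reflect.isPathFamily_profile]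
  constructor
  · rintro ⟨hj, hk, r, hr, ⟨hjk, h⟩ | ⟨hjk, h⟩⟩
    · have := (le_sliceLength_iff hA r.2 hj (k - j)).1 (by unfold profile at h; omega)
      rwa [show n - (r : ℕ) = i by omega, show j + (k - j) = k by omega] at this
    · have := (le_sliceLength_iff hA.reflect r.2 hk (j - k)).1 (by unfold profile at h; omega)
      rwa [show n - (r : ℕ) = i by omega, show k + (j - k) = j by omega, mem_reflect] at this
  · intro h
    have hpos := hA.isPlanePartition.pos _ _ _ h
    have hle := hA.le _ _ _ h
    refine ⟨hpos.2.1, hpos.2.2, ⟨n - i, by omega⟩, by simp only; omega, ?_⟩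
    rcases le_total j k with hjk | hjk
    · left
      have := (le_sliceLength_iff hA (show n - i < n by omega) hpos.2.1 (k - j)).2
        (by rwa [show n - (n - i) = i by omega, show j + (k - j) = k by omega])
      exact ⟨hjk, by unfold profile; simp only; omega⟩
    · right
      have := (le_sliceLength_iff hA.reflect (show n - i < n by omega) hpos.2.2 (j - k)).2
        (by rwa [show n - (n - i) = i by omega, show k + (j - k) = j by omega, mem_reflect])
      exact ⟨hjk, by unfold profile; simp only; omega⟩

lemma profile_reflect_zero (n : ℕ) (A : Finset (ℕ × ℕ × ℕ)) :
    profile n (reflect A) 0 = profile n A 0 := by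
  funext r
  simp only [profile, sliceLength, mem_reflect, add_zero]

lemma card_filter_add_le {n : ℕ} {A : Finset (ℕ × ℕ × ℕ)} (hA : IsCornerIdeal n A) (m e : ℕ)
    (hm : n ≤ m) : (A.filter fun x => x.2.1 + e ≤ x.2.2).card =
      ∑ s ∈ Finset.range m, ∑ r : Fin n, sliceLength n A (s + e) r := by
  rw [Finset.card_eq_sum_card_fiberwise (f := fun x : ℕ × ℕ × ℕ => (x.2.2 - x.2.1 - e, n - x.1))
    (t := Finset.range m ×ˢ Finset.range n), Finset.sum_product]
  · refine Finset.sum_congr rfl fun s _ => ?_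
    rw [Finset.sum_range]
    refine Finset.sum_congr rfl fun r _ => ?_
    symm
    refine Finset.card_bij (fun j _ => (n - r, j, j + (s + e))) ?_ ?_ ?_
    · intro j hj
      rw [Finset.mem_filter, Finset.mem_Icc] at hj
      rw [Finset.mem_filter, Finset.mem_filter]
      refine ⟨⟨hj.2, by simp only; omega⟩, ?_⟩
      simp only [Prod.mk.injEq]
      omega
    · intro j _ j' _ h
      simp only [Prod.mk.injEq] at h
      exact h.2.1
    · rintro ⟨i, j, k⟩ hx
      rw [Finset.mem_filter, Finset.mem_filter] at hx
      simp only [Prod.mk.injEq] at hx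
      obtain ⟨⟨hx, hjk⟩, hs, hr⟩ := hx
      have hpos := hA.isPlanePartition.pos _ _ _ hx
      have hle := hA.le _ _ _ hx
      have hk : j + (s + e) = k := by omega
      have hi : n - (r : ℕ) = i := by omega
      refine ⟨j, ?_, by rw [hk, hi]⟩
      rw [Finset.mem_filter, Finset.mem_Icc, hk, hi]
      exact ⟨by omega, hx⟩
  · rintro ⟨i, j, k⟩ hx
    simp only [Finset.coe_filter, Set.mem_ofPred_eq] at hx
    have hpos := hA.isPlanePartition.pos _ _ _ hx.1
    have hle := hA.le _ _ _ hx.1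
    simp only [Finset.coe_product, Finset.coe_range, Set.mem_prod, Set.mem_Iio]
    omega

/-- The cubes of `A`, counted diagonal by diagonal. -/
lemma card_eq_sum_sliceLength {n : ℕ} {A : Finset (ℕ × ℕ × ℕ)} (hA : IsCornerIdeal n A) :
    A.card = ∑ r : Fin n, sliceLength n A 0 r +
      (∑ s ∈ Finset.range n, ∑ r : Fin n, sliceLength n A (s + 1) r +
        ∑ s ∈ Finset.range n, ∑ r : Fin n, sliceLength n (reflect A) (s + 1) r) := by
  rw [← card_filter_add_le hA.reflect n 1 le_rfl, ← add_assoc]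
  have h1 := card_filter_add_le hA (n + 1) 0 (by omega)
  rw [Finset.sum_range_succ'] at h1
  simp only [add_zero] at h1
  rw [add_comm (∑ r : Fin n, sliceLength n A 0 r), ← h1,
    ← Finset.card_filter_add_card_filter_not (s := A) fun x => x.2.1 ≤ x.2.2]
  congr 1
  refine Finset.card_bij (fun x _ => (x.1, x.2.2, x.2.1)) ?_ ?_ ?_
  · rintro ⟨i, j, k⟩ hx
    rw [Finset.mem_filter] at hx
    simp only [Finset.mem_filter, mem_reflect] at hx ⊢
    exact ⟨hx.1, by omega⟩
  · rintro ⟨i, j, k⟩ _ ⟨i', j', k'⟩ _ h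
    simp only [Prod.mk.injEq] at h ⊢
    exact ⟨h.1, h.2.2, h.2.1⟩
  · rintro ⟨i, j, k⟩ hx
    simp only [Finset.mem_filter, mem_reflect] at hx
    exact ⟨(i, k, j), by simp only [Finset.mem_filter]; exact ⟨hx.1, by omega⟩, rfl⟩

lemma configSign_profile (n : ℕ) (A : Finset (ℕ × ℕ × ℕ)) (s : ℕ) :
    configSign (profile n A s) = (-1) ^ ∑ r : Fin n, sliceLength n A s r := by
  rw [configSign, ← Finset.prod_pow_eq_pow_sum]
  refine Finset.prod_congr rfl fun r _ => ?_
  rw [profile, show (r : ℕ) + sliceLength n A s r + r = sliceLength n A s r + 2 * r by ring,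
    pow_add, pow_mul]
  simp

lemma neg_one_pow_card {n : ℕ} {A : Finset (ℕ × ℕ × ℕ)} (hA : IsCornerIdeal n A) :
    (-1 : ℤ) ^ A.card = configSign (profile n A 0) *
      (familySign n (profile n A) * familySign n (profile n (reflect A))) := by
  rw [card_eq_sum_sliceLength hA, pow_add, pow_add]
  simp only [familySign, configSign_profile, Finset.prod_pow_eq_pow_sum]

/-- The signed enumeration of corner ideals, which are glued from two families of half paths with
the same starting configuration. -/
theorem sum_cornerIdeals (n : ℕ) :
    ∑ A ∈ cornerIdeals n, (-1 : ℤ) ^ A.card =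
      (∏ r : Fin n, (-1) ^ (r : ℕ)) * (pathMatrix n).det := by
  rw [← sum_startConfigs]
  simp_rw [sq, Finset.sum_mul_sum, ← Finset.sum_product', Finset.mul_sum]
  rw [Finset.sum_sigma']
  refine Finset.sum_bij'
    (fun A _ => (⟨profile n A 0, profile n A, profile n (reflect A)⟩ :
      (_ : Fin n → ℕ) × (ℕ → Fin n → ℕ) × (ℕ → Fin n → ℕ)))
    (fun x _ => ofFamilies n x.2.1 x.2.2) ?_ ?_ ?_ ?_ ?_
  · intro A hA
    rw [mem_cornerIdeals] at hA
    have h1 := hA.isPathFamily_profile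
    have h2 := hA.reflect.isPathFamily_profile
    rw [Finset.mem_sigma, Finset.mem_product, mem_pathFamilies_iff (h1.strictMono 0),
      mem_pathFamilies_iff (h1.strictMono 0)]
    exact ⟨h1.mem_startConfigs, ⟨rfl, h1⟩, profile_reflect_zero n A, h2⟩
  · rintro ⟨p, f, g⟩ hx
    rw [Finset.mem_sigma, Finset.mem_product] at hx
    have hp := (Finset.mem_filter.1 hx.1).2
    rw [mem_pathFamilies_iff hp, mem_pathFamilies_iff hp] at hx
    obtain ⟨-, ⟨hf0, hf⟩, hg0, hg⟩ := hx
    exact mem_cornerIdeals.2 (isCornerIdeal_ofFamilies hf hg (hf0.trans hg0.symm))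
  · intro A hA
    exact ofFamilies_profile (mem_cornerIdeals.1 hA)
  · rintro ⟨p, f, g⟩ hx
    rw [Finset.mem_sigma, Finset.mem_product] at hx
    have hp := (Finset.mem_filter.1 hx.1).2
    rw [mem_pathFamilies_iff hp, mem_pathFamilies_iff hp] at hx
    obtain ⟨-, ⟨hf0, hf⟩, hg0, hg⟩ := hx
    have h0 : f 0 = g 0 := hf0.trans hg0.symm
    simp only at hf0 ⊢
    rw [reflect_ofFamilies hf hg, profile_ofFamilies hf hg h0, profile_ofFamilies hg hf h0.symm]
    subst hf0
    rfl
  · intro A hA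
    exact neg_one_pow_card (mem_cornerIdeals.1 hA)

/-! ### Reduction to one eighth of the box -/

/-- The cubes of `P` in the eighth `i ≤ a`, `a < j`, `a < k`, with the last two coordinates shifted
down by `a`. -/
def corner (a : ℕ) (P : Finset (ℕ × ℕ × ℕ)) : Finset (ℕ × ℕ × ℕ) :=
  (box a a a).filter fun x => (x.1, a + x.2.1, a + x.2.2) ∈ P

lemma mem_corner {a i j k : ℕ} {P : Finset (ℕ × ℕ × ℕ)} :
    (i, j, k) ∈ corner a P ↔ (i, j, k) ∈ box a a a ∧ (i, a + j, a + k) ∈ P := by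
  rw [corner, Finset.mem_filter]

/-- The rule that extends `A` to the whole box by cyclic symmetry and transpose-complementation,
octant by octant. -/
def extensionRule (a : ℕ) (A : Finset (ℕ × ℕ × ℕ)) (i j k : ℕ) : Prop :=
  if i ≤ a then
    if j ≤ a then
      if k ≤ a then True else (2 * a + 1 - k, a + 1 - j, a + 1 - i) ∉ A
    else
      if k ≤ a then (2 * a + 1 - j, a + 1 - i, a + 1 - k) ∉ A else (i, j - a, k - a) ∈ A
  else
    if j ≤ a then
      if k ≤ a then (2 * a + 1 - i, a + 1 - k, a + 1 - j) ∉ A else (j, k - a, i - a) ∈ A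
    else
      if k ≤ a then (k, i - a, j - a) ∈ A else False

lemma extensionRule_rotate (a : ℕ) (A : Finset (ℕ × ℕ × ℕ)) (i j k : ℕ) :
    extensionRule a A j k i ↔ extensionRule a A i j k := by
  by_cases hi : i ≤ a <;> by_cases hj : j ≤ a <;> by_cases hk : k ≤ a <;>
    simp only [extensionRule, hi, hj, hk, if_true, if_false]

lemma extensionRule_compl {a : ℕ} (A : Finset (ℕ × ℕ × ℕ)) {i j k : ℕ}
    (h : (i, j, k) ∈ box (2 * a) (2 * a) (2 * a)) :
    extensionRule a A i j k ↔
      ¬ extensionRule a A (2 * a + 1 - j) (2 * a + 1 - i) (2 * a + 1 - k) := by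
  rw [mem_box] at h
  have e : ∀ x, x ≤ 2 * a → 1 ≤ x → (2 * a + 1 - x ≤ a ↔ ¬ x ≤ a) := fun x _ _ => by omega
  have e1 : ∀ x, x ≤ 2 * a → 2 * a + 1 - (2 * a + 1 - x) = x := fun x _ => by omega
  have e2 : ∀ x, ¬ x ≤ a → x ≤ 2 * a → a + 1 - (2 * a + 1 - x) = x - a := fun x _ _ => by omega
  have e3 : ∀ x, x ≤ a → 2 * a + 1 - x - a = a + 1 - x := fun x _ => by omega
  simp only [extensionRule, e i h.1.2 h.1.1, e j h.2.1.2 h.2.1.1, e k h.2.2.2 h.2.2.1]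
  by_cases hi : i ≤ a <;> by_cases hj : j ≤ a <;> by_cases hk : k ≤ a <;>
    simp only [hi, hj, hk, if_true, if_false, not_true, not_false_iff, not_not]
  · rw [e3 i hi, e3 j hj]
  · rw [e3 i hi, e3 k hk]
  · rw [e1 i (by omega), e2 j hj (by omega), e2 k hk (by omega)]
  · rw [e3 j hj, e3 k hk]
  · rw [e1 j (by omega), e2 i hi (by omega), e2 k hk (by omega)]
  · rw [e1 k (by omega), e2 i hi (by omega), e2 j hj (by omega)]

/-- Closure under decreasing the last coordinate. Inside an octant this is the corresponding
property of `A`; between octants it holds because `A` stays below the diagonals `i + j = n + 1` and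
`i + k = n + 1`. -/
lemma extensionRule_step {n i j k : ℕ} {A : Finset (ℕ × ℕ × ℕ)} (hA : IsCornerIdeal n A)
    (hb : (i, j, k + 1) ∈ box (2 * (n + 1)) (2 * (n + 1)) (2 * (n + 1))) (hk1 : 1 ≤ k)
    (h : extensionRule (n + 1) A i j (k + 1)) : extensionRule (n + 1) A i j k := by
  rw [mem_box] at hb
  obtain ⟨a, ha⟩ : ∃ a, a = n + 1 := ⟨_, rfl⟩
  have hle := hA.le
  rw [← ha] at hb h hle ⊢
  have down := hA.isPlanePartition.down
  rcases lt_trichotomy k a with hk | hk | hk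
  · have hk' : k + 1 ≤ a := hk
    by_cases hi : i ≤ a <;> by_cases hj : j ≤ a <;>
      simp only [extensionRule, hi, hj, hk', hk.le, if_true, if_false] at h ⊢
    · exact fun hc => h (down _ _ _ _ _ _ hc (by omega) (by omega) (by omega) (by omega)
        (by omega) (by omega))
    · exact fun hc => h (down _ _ _ _ _ _ hc (by omega) (by omega) (by omega) (by omega)
        (by omega) (by omega))
    · exact down _ _ _ _ _ _ h (by omega) (by omega) (by omega) (by omega) (by omega) (by omega)
  · have hk' : ¬ (k + 1 ≤ a) := by omega
    by_cases hi : i ≤ a <;> by_cases hj : j ≤ a <;>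
      simp only [extensionRule, hi, hj, hk', hk.le, if_true, if_false] at h ⊢
    · intro hc
      have h1 := hle _ _ _ h
      have h2 := hle _ _ _ hc
      omega
    · intro hc
      have h1 := hle _ _ _ h
      have h2 := hle _ _ _ hc
      omega
  · have hk' : ¬ (k + 1 ≤ a) := by omega
    have hk'' : ¬ k ≤ a := by omega
    by_cases hi : i ≤ a <;> by_cases hj : j ≤ a <;>
      simp only [extensionRule, hi, hj, hk', hk'', if_true, if_false] at h ⊢
    · exact fun hc => h (down _ _ _ _ _ _ hc (by omega) (by omega) (by omega) (by omega)
        (by omega) (by omega))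
    · exact down _ _ _ _ _ _ h (by omega) (by omega) (by omega) (by omega) (by omega) (by omega)
    · exact down _ _ _ _ _ _ h (by omega) (by omega) (by omega) (by omega) (by omega) (by omega)

open Classical in
/-- The extension of `A` to a cyclically symmetric and transpose-complementary set of cubes. -/
noncomputable def extension (a : ℕ) (A : Finset (ℕ × ℕ × ℕ)) : Finset (ℕ × ℕ × ℕ) :=
  (box (2 * a) (2 * a) (2 * a)).filter fun x => extensionRule a A x.1 x.2.1 x.2.2

lemma mem_extension {a i j k : ℕ} {A : Finset (ℕ × ℕ × ℕ)} : (i, j, k) ∈ extension a A ↔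
    (i, j, k) ∈ box (2 * a) (2 * a) (2 * a) ∧ extensionRule a A i j k := by
  classical
  rw [extension, Finset.mem_filter]

lemma mem_cstcPlanePartitions {m : ℕ} {P : Finset (ℕ × ℕ × ℕ)} : P ∈ cstcPlanePartitions m ↔
    P ⊆ box m m m ∧ IsPlanePartition P ∧ IsCyclicallySymmetric P ∧
      IsTransposeComplementary m m P := by
  classical
  rw [cstcPlanePartitions, Finset.mem_filter, Finset.mem_powerset]

lemma rotate_mem_extension {a i j k : ℕ} {A : Finset (ℕ × ℕ × ℕ)} :
    (j, k, i) ∈ extension a A ↔ (i, j, k) ∈ extension a A := by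
  rw [mem_extension, mem_extension, extensionRule_rotate, mem_box, mem_box]
  tauto

lemma extension_mem_cstcPlanePartitions {n : ℕ} {A : Finset (ℕ × ℕ × ℕ)} (hA : IsCornerIdeal n A) :
    extension (n + 1) A ∈ cstcPlanePartitions (2 * (n + 1)) := by
  have step : ∀ i j k : ℕ, 1 ≤ k → (i, j, k + 1) ∈ extension (n + 1) A →
      (i, j, k) ∈ extension (n + 1) A := by
    intro i j k hk h
    rw [mem_extension] at h ⊢
    refine ⟨?_, extensionRule_step hA h.1 hk h.2⟩
    have := h.1
    rw [mem_box] at this ⊢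
    omega
  refine mem_cstcPlanePartitions.2 ⟨?_, isPlanePartition_of_steps ?_ ?_ ?_ step, ?_, ?_⟩
  · rintro ⟨i, j, k⟩ h
    exact (mem_extension.1 h).1
  · intro i j k h
    have := (mem_extension.1 h).1
    rw [mem_box] at this
    omega
  · intro i j k hi h
    rw [← rotate_mem_extension] at h ⊢
    exact step _ _ _ hi h
  · intro i j k hj h
    rw [← rotate_mem_extension, ← rotate_mem_extension] at h ⊢
    exact step _ _ _ hj h
  · exact fun i j k h => rotate_mem_extension.2 h
  · intro i j k h
    rw [mem_extension, mem_extension, extensionRule_compl A h]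
    have h' : (2 * (n + 1) + 1 - j, 2 * (n + 1) + 1 - i, 2 * (n + 1) + 1 - k) ∈
        box (2 * (n + 1)) (2 * (n + 1)) (2 * (n + 1)) := by
      rw [mem_box] at h ⊢
      omega
    simp only [h, h', true_and]

/-- If a cube of the corner violated one of the inequalities, `P` would contain a cube of a
neighbouring octant together with its image under transpose-complementation. -/
lemma isCornerIdeal_corner {n : ℕ} {P : Finset (ℕ × ℕ × ℕ)}
    (hP : P ∈ cstcPlanePartitions (2 * (n + 1))) : IsCornerIdeal n (corner (n + 1) P) := by
  obtain ⟨hbox, hpp, hcyc, htc⟩ := mem_cstcPlanePartitions.1 hP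
  obtain ⟨a, ha⟩ : ∃ a, a = n + 1 := ⟨_, rfl⟩
  rw [← ha] at htc hbox ⊢
  refine ⟨⟨fun i j k h => ?_, fun i j k i' j' k' h hi hi' hj hj' hk hk' => ?_⟩, fun i j k h => ?_⟩
  · have := (mem_corner.1 h).1
    rw [mem_box] at this
    omega
  · rw [mem_corner, mem_box] at h ⊢
    exact ⟨by omega, hpp.down _ _ _ _ _ _ h.2 hi hi' (by omega) (by omega) (by omega) (by omega)⟩
  · rw [mem_corner, mem_box] at h
    obtain ⟨hb, h⟩ := h
    constructor
    · by_contra hlt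
      have h1 := hpp.down _ _ _ i (a + j) a h (by omega) le_rfl (by omega) le_rfl (by omega)
        (by omega)
      refine (htc i (a + j) a (hbox h1)).1 h1 ?_
      exact hpp.down _ _ _ _ _ _ h (by omega) (by omega) (by omega) (by omega) (by omega)
        (by omega)
    · by_contra hlt
      have h1 := hcyc _ _ _ (hpp.down _ _ _ i a (a + k) h (by omega) le_rfl (by omega) (by omega)
        (by omega) le_rfl)
      refine (htc a (a + k) i (hbox h1)).1 h1 ?_
      exact hpp.down _ _ _ _ _ _ h (by omega) (by omega) (by omega) (by omega) (by omega)
        (by omega)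

lemma corner_extension {n : ℕ} {A : Finset (ℕ × ℕ × ℕ)} (hA : IsCornerIdeal n A) :
    corner (n + 1) (extension (n + 1) A) = A := by
  ext ⟨i, j, k⟩
  rw [mem_corner, mem_extension]
  constructor
  · rintro ⟨hb, -, h⟩
    rw [mem_box] at hb
    rw [extensionRule, if_pos (by omega), if_neg (by omega), if_neg (by omega),
      Nat.add_sub_cancel_left, Nat.add_sub_cancel_left] at h
    exact h
  · intro h
    have h1 := hA.isPlanePartition.pos _ _ _ h
    have h2 := hA.le _ _ _ h
    refine ⟨by rw [mem_box]; omega, by rw [mem_box]; omega, ?_⟩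
    rw [extensionRule, if_pos (by omega), if_neg (by omega), if_neg (by omega),
      Nat.add_sub_cancel_left, Nat.add_sub_cancel_left]
    exact h

lemma extension_corner {a : ℕ} {P : Finset (ℕ × ℕ × ℕ)} (hP : P ∈ cstcPlanePartitions (2 * a)) :
    extension a (corner a P) = P := by
  obtain ⟨hbox, hpp, hcyc, htc⟩ := mem_cstcPlanePartitions.1 hP
  have hrot : ∀ i j k, (j, k, i) ∈ P ↔ (i, j, k) ∈ P :=
    fun i j k => ⟨fun h => hcyc _ _ _ (hcyc _ _ _ h), hcyc i j k⟩
  -- every octant other than the two on the main diagonal can be rotated into this position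
  have h1 : ∀ i j k, (i, j, k) ∈ box (2 * a) (2 * a) (2 * a) → i ≤ a → a < j →
      (extensionRule a (corner a P) i j k ↔ (i, j, k) ∈ P) := by
    intro i j k hb hi hj
    have hb' := mem_box.1 hb
    by_cases hk : k ≤ a
    · rw [extensionRule, if_pos hi, if_neg (by omega), if_pos hk, htc i j k hb, mem_corner, mem_box,
        show a + (a + 1 - i) = 2 * a + 1 - i by omega,
        show a + (a + 1 - k) = 2 * a + 1 - k by omega,
        not_iff_not]
      exact ⟨fun h => h.2, fun h => ⟨by omega, h⟩⟩
    · rw [extensionRule, if_pos hi, if_neg (by omega), if_neg hk, mem_corner, mem_box,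
        show a + (j - a) = j by omega, show a + (k - a) = k by omega]
      exact ⟨fun h => h.2, fun h => ⟨by omega, h⟩⟩
  ext ⟨i, j, k⟩
  rw [mem_extension]
  by_cases hb : (i, j, k) ∈ box (2 * a) (2 * a) (2 * a)
  · simp only [hb, true_and]
    have hb' := mem_box.1 hb
    by_cases hi : i ≤ a <;> by_cases hj : j ≤ a
    · by_cases hk : k ≤ a
      · simp only [extensionRule, hi, hj, hk, if_true, true_iff]
        by_contra hn
        have h2 := (not_congr (htc i j k hb)).1 hn
        rw [not_not] at h2
        exact hn (hpp.down _ _ _ _ _ _ h2 (by omega) (by omega) (by omega) (by omega) (by omega)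
          (by omega))
      · rw [← extensionRule_rotate, ← hrot]
        exact h1 _ _ _ (by rw [mem_box]; omega) hj (by omega)
    · exact h1 _ _ _ hb hi (by omega)
    · by_cases hk : k ≤ a
      · rw [extensionRule_rotate a _ k i j, hrot k i j]
        exact h1 _ _ _ (by rw [mem_box]; omega) hk (by omega)
      · rw [← extensionRule_rotate, ← hrot]
        exact h1 _ _ _ (by rw [mem_box]; omega) hj (by omega)
    · by_cases hk : k ≤ a
      · rw [extensionRule_rotate a _ k i j, hrot k i j]
        exact h1 _ _ _ (by rw [mem_box]; omega) hk (by omega)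
      · simp only [extensionRule, hi, hj, hk, if_false, false_iff]
        intro h
        exact (htc i j k hb).1 h (hpp.down _ _ _ _ _ _ h (by omega) (by omega) (by omega)
          (by omega) (by omega) (by omega))
  · simp only [hb, false_and, false_iff]
    exact fun h => hb (hbox h)

lemma card_corner {a : ℕ} {P : Finset (ℕ × ℕ × ℕ)}
    (hbox : P ⊆ box (2 * a) (2 * a) (2 * a)) : (corner a P).card = upperRightCubes a P := by
  refine Finset.card_bij (fun x _ => (x.1, a + x.2.1, a + x.2.2)) ?_ ?_ ?_
  · rintro ⟨i, j, k⟩ h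
    rw [mem_corner, mem_box] at h
    simp only [Finset.mem_filter]
    exact ⟨h.2, by omega⟩
  · rintro ⟨i, j, k⟩ _ ⟨i', j', k'⟩ _ h
    simp only [Prod.mk.injEq] at h ⊢
    omega
  · rintro ⟨i, j, k⟩ h
    simp only [Finset.mem_filter] at h
    have hb := mem_box.1 (hbox h.1)
    have hj : a + (j - a) = j := by omega
    have hk : a + (k - a) = k := by omega
    refine ⟨(i, j - a, k - a), ?_, by simp only [hj, hk]⟩
    rw [mem_corner, mem_box, hj, hk]
    exact ⟨by omega, h.1⟩

lemma cstcMinusOneEnumeration_eq (n : ℕ) :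
    cstcMinusOneEnumeration (n + 1) = ∑ A ∈ cornerIdeals n, (-1 : ℤ) ^ A.card := by
  refine Finset.sum_bij' (fun P _ => corner (n + 1) P) (fun A _ => extension (n + 1) A)
    ?_ ?_ ?_ ?_ ?_
  · exact fun P hP => mem_cornerIdeals.2 (isCornerIdeal_corner hP)
  · exact fun A hA => extension_mem_cstcPlanePartitions (mem_cornerIdeals.1 hA)
  · exact fun P hP => extension_corner hP
  · exact fun A hA => corner_extension (mem_cornerIdeals.1 hA)
  · intro P hP
    have h := mem_cstcPlanePartitions.1 hP
    rw [card_corner h.1]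

/-! ### The enumeration -/

theorem theorem4 (α : ℕ) (hα : 1 ≤ α) :
    (Odd α → (cstcMinusOneEnumeration α : ℚ) =
      (∏ k ∈ Finset.Icc 1 ((α - 1) / 2),
        ((6 * k - 2).factorial : ℚ) / ((2 * k + α - 1).factorial : ℚ)) ^ 2) ∧
    (Even α → cstcMinusOneEnumeration α = 0) := by
  obtain ⟨n, rfl⟩ : ∃ n, α = n + 1 := ⟨α - 1, by omega⟩
  rw [cstcMinusOneEnumeration_eq, sum_cornerIdeals]
  constructor
  · rintro ⟨m, hm⟩
    obtain rfl : n = 2 * m := by omega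
    have hsign : ∏ r : Fin (2 * m), (-1 : ℚ) ^ (r : ℕ) = (-1) ^ m := by
      rw [Fin.prod_univ_eq_prod_range (fun r => (-1 : ℚ) ^ r) (2 * m)]
      clear hm hα
      induction m with
      | zero => simp
      | succ m ih =>
        rw [show 2 * (m + 1) = 2 * m + 1 + 1 by ring, Finset.prod_range_succ,
          Finset.prod_range_succ, ih, pow_succ _ (2 * m), pow_mul]
        norm_num
        ring
    rw [Int.cast_mul, Int.cast_prod, det_pathMatrix_even]
    simp only [Int.cast_pow, Int.cast_neg, Int.cast_one]
    rw [hsign, ← mul_assoc, ← mul_pow, det_mrrMatrix]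
    simp only [mul_neg, mul_one, neg_neg, one_pow, one_mul, Nat.add_sub_cancel]
    rw [Nat.mul_div_cancel_left m two_pos]
    simp only [← Nat.add_assoc, Nat.add_sub_cancel]
  · rintro ⟨m, hm⟩
    obtain rfl : n = 2 * (m - 1) + 1 := by omega
    rw [det_pathMatrix_odd, mul_zero]
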